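/- Let $R=\mathbb C[x,y,z]$ and let $Y=V(F)\subset\mathbb P^2$ be a reduced curve of degree $d\ge 2$, i.e. $F\in R$ is a squarefree homogeneous polynomial of degree $d$. Write $F_x,F_y,F_z$ for its partial derivatives. Assume that $Y$ is quasihomogeneous: at every common zero $P\in\mathbb P^2$ of $F_x,F_y,F_z$ there are local holomorphic coordinates of $\mathbb P^2$ centred at $P$ in which a local equation of $Y$ is, up to multiplication by a nowhere vanishing holomorphic function, a polynomial $\sum c_{ij}s^it^j$ that is weighted homogeneous for some positive rational weights $\alpha,\beta$ (that is, $\alpha i+\beta j$ is constant over all $(i,j)$ with $c_{ij}\ne 0$). Then $Y$ is free, i.e. the $R$-module $D(Y)=\{\theta\in \mathrm{Der}_{\mathbb C}(R) : \theta(F)\in\langle F\rangle\}$ is free, if and only if there are $A,B,C\in R$ with $AF_x+BF_y+CF_z=0$ such that $A,B,C$ is an $R$-regular sequence. Moreover, if $Y$ is free, then such $A,B,C$ can be chosen homogeneous of the same degree. -/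

import Mathlib

open Filter Topology

noncomputable section

namespace PlaneCurve

/-- The homogeneous coordinate ring `R = ℂ[x, y, z]` of the projective plane, with
`x = X 0`, `y = X 1`, `z = X 2`. -/
abbrev R : Type := MvPolynomial (Fin 3) ℂ

/-- The module of logarithmic derivations
`D(Y) = {θ ∈ Der_ℂ(R) | θ(F) ∈ ⟨F⟩}` of `Y = V(F)`. -/
def logDer (F : R) : Submodule R (Derivation ℂ R R) where
  carrier := {θ | θ F ∈ Ideal.span {F}}
  add_mem' := by
    intro a b ha hb
    exact (Ideal.span {F}).add_mem ha hb
  zero_mem' := (Ideal.span {F}).zero_mem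
  smul_mem' := by
    intro c a ha
    exact (Ideal.span {F}).mul_mem_left c ha

/-- `Y = V(F)` is free if `D(Y)` is a free `R`-module. -/
def IsFreeDivisor (F : R) : Prop := Module.Free R (logDer F)

/-- The zero set of a germ `f : (ℂ², 0) → ℂ` is quasihomogeneous: after a local biholomorphic
change of coordinates `φ` fixing the origin, and up to a nowhere vanishing holomorphic factor `u`,
`f` is a polynomial `g = ∑ c_{ij} x^i y^j` which is weighted homogeneous with positive rational
weights `α = w 0`, `β = w 1`. -/
def IsQuasihomogeneousGerm (f : (Fin 2 → ℂ) → ℂ) : Prop :=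
  ∃ (φ : (Fin 2 → ℂ) → (Fin 2 → ℂ)) (φ' : (Fin 2 → ℂ) ≃L[ℂ] (Fin 2 → ℂ))
    (u : (Fin 2 → ℂ) → ℂ) (g : MvPolynomial (Fin 2) ℂ) (w : Fin 2 → ℚ) (m : ℚ),
    AnalyticAt ℂ φ 0 ∧ φ 0 = 0 ∧
    HasFDerivAt φ (φ' : (Fin 2 → ℂ) →L[ℂ] (Fin 2 → ℂ)) 0 ∧
    AnalyticAt ℂ u 0 ∧ u 0 ≠ 0 ∧
    (∀ i, 0 < w i) ∧ MvPolynomial.IsWeightedHomogeneous w g m ∧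
    ∀ᶠ q in 𝓝 0, f (φ q) = u q * MvPolynomial.eval q g

/-- The equation of `V(F)` in the affine chart `(s, t) ↦ [p + s v + t w]` of the projective plane.
When `p, v, w` is a basis of `ℂ³`, this is an affine chart centred at the point `[p]`
(for `p = (0,0,1)`, `v = (1,0,0)`, `w = (0,1,0)` it is `F(s, t, 1)`). -/
def affineEquation (F : R) (p v w : Fin 3 → ℂ) : (Fin 2 → ℂ) → ℂ :=
  fun q => MvPolynomial.eval (p + q 0 • v + q 1 • w) F

/-- `V(F)` is quasihomogeneous at the point `[p]` of the projective plane: its local equation in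
an affine chart centred at `[p]` is quasihomogeneous. (All such charts differ by local
biholomorphisms, and the local equations by units, so the choice does not matter.) -/
def IsQuasihomogeneousAt (F : R) (p : Fin 3 → ℂ) : Prop :=
  ∃ v w : Fin 3 → ℂ, LinearIndependent ℂ ![p, v, w] ∧
    IsQuasihomogeneousGerm (affineEquation F p v w)

/-- `V(F)` is quasihomogeneous: it is so at every point `[p]` of `V(J_F)`, i.e. at every common
zero of the partial derivatives of `F` in the projective plane. -/
def IsQuasihomogeneousCurve (F : R) : Prop :=
  ∀ p : Fin 3 → ℂ, p ≠ 0 → (∀ i, MvPolynomial.eval p (MvPolynomial.pderiv i F) = 0) →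
    IsQuasihomogeneousAt F p

/-- `(A, B, C)` is a syzygy on the partial derivatives of `F`: `A F_x + B F_y + C F_z = 0`. -/
def IsJacobianSyzygy (F A B C : R) : Prop :=
  A * MvPolynomial.pderiv 0 F + B * MvPolynomial.pderiv 1 F + C * MvPolynomial.pderiv 2 F = 0

end PlaneCurve

end

open scoped Matrix Topology ContDiff
open MvPolynomial Asymptotics

/-! Derivations are handled as coefficient vectors in `R³`. By Euler's relation `D(Y)` is the direct
sum of the span of the Euler field `X` and the module of syzygies of `grad F`. Squarefreeness makes
`grad F` primitive, so any two syzygies have a cross product that is a multiple of `grad F`.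

A regular syzygy gives freeness (`isFreeDivisor_of_isRegular`): the Koszul complex of `u = (A, B,
C)` is exact, so `grad F = u ⨯₃ v` for some `v`, and `u`, `v` are a basis of the syzygies.
Quasihomogeneity plays no role in this direction.

Conversely, if `Y` is free, graded Nakayama gives two homogeneous syzygies `u`, `v` of degrees `a ≤
b` that generate all of them (`exists_homogeneous_generators`), and `u ⨯₃ v` is `grad F` up to a
unit (`exists_isUnit_cross_eq_smul`). Hence for any form `α` of degree `b - a`, the zeros of `α • u
+ v` are singular points of `Y`. At a singular point `p`, quasihomogeneity puts the local equation
into its Jacobian ideal. Subtracting the resulting vector field from the Euler field gives an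
analytic syzygy with value `p` at `p`, and Artin–Rees replaces it by a polynomial one
(`IsQuasihomogeneousAt.exists_syzygy`). So `u` and `v` do not both vanish there. As there are
finitely many singular points, a general `α` leaves no zero of `α • u + v` but the origin
(`exists_smul_add_zeroLocus`), and three forms of equal positive degree with that property are a
regular sequence (`isRegular_of_zeroLocus`). -/

theorem isRegular_triple_iff {S : Type*} [CommRing S] {A B C : S} :
    RingTheory.Sequence.IsRegular S [A, B, C] ↔
      (∀ x, A * x = 0 → x = 0) ∧ (∀ x, B * x ∈ Ideal.span {A} → x ∈ Ideal.span {A}) ∧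
      (∀ x, C * x ∈ Ideal.span {A, B} → x ∈ Ideal.span {A, B}) ∧
      Ideal.span {A, B, C} ≠ ⊤ := by
  have quot (I : Ideal S) (r : S) : IsSMulRegular (S ⧸ (I • ⊤ : Submodule S S)) r ↔
      ∀ x, r * x ∈ I → x ∈ I := by
    simp only [isSMulRegular_quotient_iff_mem_of_smul_mem, smul_eq_mul, Ideal.mul_top]
  have ofL2 : Ideal.ofList [A, B] = Ideal.span {A, B} := by
    simp [Ideal.span_insert]
  have ofL3 : Ideal.ofList [A, B, C] = Ideal.span {A, B, C} := by
    simp [Ideal.span_insert]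
  constructor
  · rintro ⟨⟨h⟩, htop⟩
    refine ⟨?_, ?_, ?_, ?_⟩
    · simpa using (quot _ _).1 (h 0 (by simp))
    · simpa using (quot _ _).1 (h 1 (by simp))
    · have := (quot _ _).1 (h 2 (by simp))
      rwa [show List.take 2 [A, B, C] = [A, B] from rfl, ofL2] at this
    · rw [← ofL3]
      simpa [eq_comm] using htop
  · rintro ⟨h0, h1, h2, h3⟩
    refine ⟨⟨fun i hi => (quot _ _).2 ?_⟩, ?_⟩
    · match i, hi with
      | 0, _ => simpa using h0
      | 1, _ => simpa using h1
      | 2, _ =>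
        rw [show List.take 2 [A, B, C] = [A, B] from rfl, ofL2]
        exact h2
    · rw [ofL3, smul_eq_mul, Ideal.mul_top]
      exact h3.symm

/-- A vector is primitive if its entries have no common divisor apart from units. -/
def IsPrimitive {S ι : Type*} [CommRing S] (n : ι → S) : Prop :=
  ∀ g, (∀ i, g ∣ n i) → IsUnit g

/-! ### Cross products, primitive vectors and the Koszul complex -/

section Cross

variable {S : Type*} [CommRing S]

theorem cross_eq_zero_iff {c n : Fin 3 → S} : c ⨯₃ n = 0 ↔ ∀ i j, c i * n j = c j * n i := by
  rw [cross_apply, funext_iff]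
  constructor
  · intro h i j
    have h0 := h 0
    have h1 := h 1
    have h2 := h 2
    simp only [Matrix.cons_val_zero, Matrix.cons_val_one, Matrix.cons_val, Pi.zero_apply] at h0 h1 h2
    fin_cases i <;> fin_cases j <;> simp only [Fin.zero_eta, Fin.mk_one, Fin.reduceFinMk] <;>
      grind
  · intro h i
    fin_cases i <;> simp [h 1 2, h 2 0, h 0 1]

theorem exists_smul_of_cross_eq_zero [IsDomain S] [UniqueFactorizationMonoid S]
    {c n : Fin 3 → S} (hn : IsPrimitive n) (h : c ⨯₃ n = 0) : ∃ r : S, c = r • n := by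
  classical
  rw [cross_eq_zero_iff] at h
  obtain ⟨i, hi⟩ : ∃ i, n i ≠ 0 := by
    by_contra! h0
    exact not_isUnit_zero (hn 0 fun i => by simp [h0])
  let _ := UniqueFactorizationMonoid.toGCDMonoid S
  -- Since `n i` divides every `c i * n j`, it divides `c i` times the gcd of the entries of `n`,
  -- which is a unit.
  have hdvd : n i ∣ c i := by
    have h1 (j) : n i ∣ c i * n j := ⟨c j, by rw [h i j, mul_comm]⟩
    have h2 : IsUnit (gcd (n 0) (gcd (n 1) (n 2))) := hn _ fun j => by
      fin_cases j
      exacts [gcd_dvd_left _ _, (gcd_dvd_right _ _).trans (gcd_dvd_left _ _),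
        (gcd_dvd_right _ _).trans (gcd_dvd_right _ _)]
    have h3 : n i ∣ c i * gcd (n 0) (gcd (n 1) (n 2)) :=
      (dvd_gcd (h1 0) ((dvd_gcd (h1 1) (h1 2)).trans (gcd_mul_left' _ _ _).dvd)).trans
        (gcd_mul_left' _ _ _).dvd
    exact h2.dvd_mul_right.1 h3
  obtain ⟨r, hr⟩ := hdvd
  refine ⟨r, funext fun j => mul_left_cancel₀ hi ?_⟩
  rw [Pi.smul_apply, smul_eq_mul, mul_comm, ← h i j, hr]
  ring

theorem cross_cross_eq_zero_of_dotProduct {n u v : Fin 3 → S} (hu : n ⬝ᵥ u = 0)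
    (hv : n ⬝ᵥ v = 0) : (u ⨯₃ v) ⨯₃ n = 0 := by
  rw [cross_cross_eq_smul_sub_smul, dotProduct_comm u, dotProduct_comm v, hu, hv]
  simp

theorem exists_cross_eq_smul [IsDomain S] [UniqueFactorizationMonoid S] {n u v : Fin 3 → S}
    (hn : IsPrimitive n) (hu : n ⬝ᵥ u = 0) (hv : n ⬝ᵥ v = 0) : ∃ r : S, u ⨯₃ v = r • n :=
  exists_smul_of_cross_eq_zero hn (cross_cross_eq_zero_of_dotProduct hu hv)

/-- Exactness of the Koszul complex of a regular sequence in the middle. -/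
theorem exists_eq_cross_of_isRegular {A B C : S} (hreg : RingTheory.Sequence.IsRegular S [A, B, C])
    {n : Fin 3 → S} (hn : n ⬝ᵥ ![A, B, C] = 0) : ∃ v, n = ![A, B, C] ⨯₃ v := by
  obtain ⟨h0, h1, h2, -⟩ := isRegular_triple_iff.1 hreg
  simp only [dotProduct, Fin.sum_univ_three, Matrix.cons_val_zero, Matrix.cons_val_one,
    Matrix.cons_val] at hn
  obtain ⟨a, b, hab⟩ := Ideal.mem_span_pair.1 (h2 (n 2)
    (Ideal.mem_span_pair.2 ⟨-n 0, -n 1, by linear_combination -hn⟩))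
  obtain ⟨c, hc⟩ := Ideal.mem_span_singleton.1 (h1 (n 1 + b * C)
    (Ideal.mem_span_singleton.2 ⟨-(n 0 + a * C), by rw [← hab] at hn; linear_combination hn⟩))
  have h3 : n 0 + a * C = -(c * B) := sub_eq_zero.1 <| h0 _ <| by
    rw [← hab] at hn
    linear_combination hn - B * hc
  refine ⟨![-b, a, -c], funext fun i => ?_⟩
  rw [cross_apply]
  fin_cases i <;> simp <;> [linear_combination h3; linear_combination hc; linear_combination -hab]

/-- If `A = g a` and `B = g b`, then `B a = A b`, so regularity gives `a = A k`; hence `A = g k A`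
and `g` is a unit. -/
theorem isPrimitive_of_isRegular [IsDomain S] {A B C : S}
    (hreg : RingTheory.Sequence.IsRegular S [A, B, C]) : IsPrimitive ![A, B, C] := by
  obtain ⟨h0, h1, -, -⟩ := isRegular_triple_iff.1 hreg
  intro g hg
  obtain ⟨a, ha⟩ : g ∣ A := hg 0
  obtain ⟨b, hb⟩ : g ∣ B := hg 1
  have hA : A ≠ 0 := fun h => one_ne_zero (h0 1 (by simp [h]))
  obtain ⟨k, hk⟩ := Ideal.mem_span_singleton.1
    (h1 a (Ideal.mem_span_singleton.2 ⟨b, by rw [ha, hb]; ring⟩))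
  refine IsUnit.of_mul_eq_one k (mul_left_cancel₀ hA ?_)
  linear_combination -g * hk - ha

end Cross

/-! ### A regular syzygy makes the curve free -/

namespace PlaneCurve

/-- The gradient `(F_x, F_y, F_z)`. -/
noncomputable def grad (F : R) : Fin 3 → R := fun i => pderiv i F

theorem isJacobianSyzygy_iff {F A B C : R} :
    IsJacobianSyzygy F A B C ↔ grad F ⬝ᵥ ![A, B, C] = 0 := by
  simp only [IsJacobianSyzygy, grad, dotProduct, Fin.sum_univ_three, Matrix.cons_val_zero,
    Matrix.cons_val_one, Matrix.cons_val, mul_comm]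

theorem mkDerivation_apply_eq_dotProduct (v : Fin 3 → R) (F : R) :
    mkDerivation ℂ v F = grad F ⬝ᵥ v := by
  have : mkDerivation ℂ v = ∑ i, v i • pderiv i := by
    refine derivation_ext fun j => ?_
    rw [mkDerivation_X, Fin.sum_univ_three]
    fin_cases j <;> simp [pderiv_X]
  rw [this, dotProduct, Fin.sum_univ_three, Fin.sum_univ_three]
  simp [grad, mul_comm]

theorem exists_eq_mkDerivation (θ : Derivation ℂ R R) : ∃ v, θ = mkDerivation ℂ v :=
  ⟨fun i => θ (X i), derivation_ext fun i => by simp⟩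

theorem grad_dotProduct_X {F : R} {d : ℕ} (hF : F.IsHomogeneous d) :
    grad F ⬝ᵥ X = C (d : ℂ) * F := by
  have := hF.sum_X_mul_pderiv
  simp only [dotProduct, grad, mul_comm _ (X _ : R), this, nsmul_eq_mul, map_natCast]

theorem eq_C_of_pderiv_eq_zero {f : R} (h : ∀ i, pderiv i f = 0) : f = C (coeff 0 f) := by
  ext m
  rw [coeff_C]
  split_ifs with hm
  · rw [hm]
  · obtain ⟨i, hi⟩ : ∃ i, m i ≠ 0 := by
      by_contra! h0
      exact hm (Finsupp.ext fun i => (h0 i).symm)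
    have h1 := congrArg (coeff (m - Finsupp.single i 1)) (h i)
    rw [coeff_pderiv, coeff_zero, tsub_add_cancel_of_le
      (Finsupp.single_le_iff.2 (Nat.one_le_iff_ne_zero.2 hi))] at h1
    refine (mul_eq_zero.1 h1).resolve_right ?_
    exact Nat.cast_add_one_ne_zero _

theorem totalDegree_pderiv_lt {f : R} {i : Fin 3} (h : pderiv i f ≠ 0) :
    (pderiv i f).totalDegree < f.totalDegree := by
  obtain ⟨m, hm, hm'⟩ := Finset.exists_mem_eq_sup _ (support_nonempty.2 h) fun s => s.sum fun _ e => e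
  rw [totalDegree, hm']
  rw [mem_support_iff, coeff_pderiv] at hm
  have h1 : (m + Finsupp.single i 1).sum (fun _ e => e) ≤ f.totalDegree :=
    le_totalDegree (mem_support_iff.2 (left_ne_zero_of_mul hm))
  rw [Finsupp.sum_add_index' (by simp) (by simp), Finsupp.sum_single_index rfl] at h1
  omega

theorem pderiv_eq_zero_of_dvd {g : R} {i : Fin 3} (h : g ∣ pderiv i g) : pderiv i g = 0 := by
  by_contra h0
  exact absurd (totalDegree_le_of_dvd_of_isDomain h h0) (totalDegree_pderiv_lt h0).not_ge

/-- A common irreducible factor `p` of the partials divides `F` by Euler's relation, say `F = p k`,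
and `p ∤ k` as `F` is squarefree. The product rule then makes `p` divide its own partials, so these
vanish for degree reasons and `p` is constant. -/
theorem isPrimitive_grad {F : R} {d : ℕ} (hd : d ≠ 0) (hF : F.IsHomogeneous d)
    (hred : Squarefree F) : IsPrimitive (grad F) := by
  have hFdvd (g : R) (hg : ∀ i, g ∣ grad F i) : g ∣ F := by
    have h1 : g ∣ C (d : ℂ) * F := by
      rw [← grad_dotProduct_X hF]
      exact Finset.dvd_sum fun i _ => (hg i).mul_right _
    have h2 : IsUnit (C (d : ℂ) : R) := (Nat.cast_ne_zero.2 hd).isUnit.map C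
    exact h2.dvd_mul_left.1 h1
  intro g hg
  by_contra hgu
  obtain ⟨p, hp, hpg⟩ := WfDvdMonoid.exists_irreducible_factor hgu
    (fun h0 => hred.ne_zero (zero_dvd_iff.1 (h0 ▸ hFdvd g hg)))
  have hpF (i) : p ∣ grad F i := hpg.trans (hg i)
  obtain ⟨k, rfl⟩ := hFdvd p hpF
  have hpk : ¬ p ∣ k := fun h => hp.not_isUnit (hred p (mul_dvd_mul_left p h))
  have hpd (i) : p ∣ pderiv i p := by
    have h1 := hpF i
    rw [grad, Derivation.leibniz, smul_eq_mul, smul_eq_mul, dvd_add_right (dvd_mul_right _ _)] at h1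
    exact (hp.prime.dvd_or_dvd h1).resolve_left hpk
  have hpC := eq_C_of_pderiv_eq_zero fun i => pderiv_eq_zero_of_dvd (hpd i)
  have h0 : coeff 0 p ≠ 0 := fun h => hp.ne_zero (by rw [hpC, h, map_zero])
  exact hp.not_isUnit (hpC ▸ h0.isUnit.map C)

theorem mkDerivation_mem_logDer_iff {F : R} {v : Fin 3 → R} :
    mkDerivation ℂ v ∈ logDer F ↔ F ∣ grad F ⬝ᵥ v := by
  rw [← mkDerivation_apply_eq_dotProduct, ← Ideal.mem_span_singleton]
  rfl

/-- If the syzygies of the gradient are generated by two elements with non-zero cross product, then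
the curve is free. -/
theorem isFreeDivisor_of_syzygies {F : R} {d : ℕ} (hd : d ≠ 0) (hF : F.IsHomogeneous d)
    (hF0 : F ≠ 0) {u v : Fin 3 → R} (hu : grad F ⬝ᵥ u = 0) (hv : grad F ⬝ᵥ v = 0)
    (huv : u ⨯₃ v ≠ 0) (hspan : ∀ w, grad F ⬝ᵥ w = 0 → ∃ a b : R, w = a • u + b • v) :
    IsFreeDivisor F := by
  have hdC : (C (d : ℂ) : R) ≠ 0 := by simpa using hd
  -- The basis of `D(Y)` will be the Euler field together with `u` and `v`.
  let L : (Fin 3 → R) →ₗ[R] (Fin 3 → R) := Fintype.linearCombination R ![X, u, v]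
  have hL (c : Fin 3 → R) : L c = c 0 • X + c 1 • u + c 2 • v := by
    simp [L, Fintype.linearCombination_apply, Fin.sum_univ_three]
  have hLF (c : Fin 3 → R) : grad F ⬝ᵥ L c = c 0 * (C (d : ℂ) * F) := by
    simp [hL, dotProduct_add, dotProduct_smul, hu, hv, grad_dotProduct_X hF]
  let Φ : (Fin 3 → R) →ₗ[R] logDer F :=
    LinearMap.codRestrict (logDer F)
      ({ toFun := fun c => mkDerivation ℂ (L c)
         map_add' := fun a b => by
          rw [map_add]; exact derivation_ext fun i => by simp
         map_smul' := fun a b => by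
          rw [map_smul]; exact derivation_ext fun i => by simp } :
        (Fin 3 → R) →ₗ[R] Derivation ℂ R R)
      fun c => mkDerivation_mem_logDer_iff.2 ⟨c 0 * C (d : ℂ), by rw [hLF]; ring⟩
  have hΦ (c) : (Φ c : Derivation ℂ R R) = mkDerivation ℂ (L c) := rfl
  have hbij : Function.Bijective Φ := by
    constructor
    · rw [injective_iff_map_eq_zero]
      intro c hc
      have h1 : L c = 0 := funext fun i => by
        have := congrArg (fun θ : logDer F => (θ : Derivation ℂ R R) (X i)) hc
        simpa [hΦ] using this
      have h2 : c 0 = 0 := by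
        have := hLF c
        rw [h1, dotProduct_zero, eq_comm] at this
        exact (mul_eq_zero.1 this).resolve_right (mul_ne_zero hdC hF0)
      rw [hL, h2, zero_smul, zero_add] at h1
      have h3 : c 1 = 0 := by
        have := congrArg (fun w => w ⨯₃ v) h1
        simp only [map_add, map_smul, LinearMap.add_apply, LinearMap.smul_apply, cross_self,
          smul_zero, add_zero, map_zero, LinearMap.zero_apply] at this
        exact (smul_eq_zero.1 this).resolve_right huv
      have h4 : c 2 = 0 := by
        have := congrArg (fun w => u ⨯₃ w) h1
        simp only [map_add, map_smul, cross_self, smul_zero, zero_add, map_zero] at this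
        exact (smul_eq_zero.1 this).resolve_right huv
      funext i
      fin_cases i <;> simp [h2, h3, h4]
    · rintro ⟨θ, hθ⟩
      obtain ⟨w, rfl⟩ := exists_eq_mkDerivation θ
      obtain ⟨k, hk⟩ := mkDerivation_mem_logDer_iff.1 hθ
      have hd' : (C (d : ℂ) : R) * C (d : ℂ)⁻¹ = 1 := by
        rw [← C_mul, mul_inv_cancel₀ (Nat.cast_ne_zero.2 hd), C_1]
      -- Euler's relation shows that this multiple of the Euler field has the same value `F * k` on
      -- `F` as `w`.
      obtain ⟨a, b, hab⟩ := hspan (w - (k * C (d : ℂ)⁻¹) • X) (by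
        rw [dotProduct_sub, dotProduct_smul, grad_dotProduct_X hF, hk, smul_eq_mul]
        linear_combination -F * k * hd')
      refine ⟨![k * C (d : ℂ)⁻¹, a, b], Subtype.ext ?_⟩
      rw [hΦ, hL]
      congr 1
      simp only [Matrix.cons_val_zero, Matrix.cons_val_one, Matrix.cons_val]
      rw [add_assoc, ← hab, add_sub_cancel]
  exact Module.Free.of_equiv (LinearEquiv.ofBijective Φ hbij)

/-- With `grad F = u ⨯₃ v`, any syzygy `w` satisfies `w ⨯₃ u = r • (u ⨯₃ v)`, that is `(w + r • v)
⨯₃ u = 0`. As `u` is primitive, `w + r • v` is a multiple of `u`. -/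
theorem isFreeDivisor_of_isRegular {F : R} {d : ℕ} (hd : d ≠ 0) (hF : F.IsHomogeneous d)
    (hred : Squarefree F) {A B C : R} (hsyz : IsJacobianSyzygy F A B C)
    (hreg : RingTheory.Sequence.IsRegular R [A, B, C]) : IsFreeDivisor F := by
  have hprim := isPrimitive_grad hd hF hred
  rw [isJacobianSyzygy_iff] at hsyz
  obtain ⟨v, hv⟩ := exists_eq_cross_of_isRegular hreg hsyz
  set u := ![A, B, C]
  have hg0 : u ⨯₃ v ≠ 0 := by
    rw [← hv]
    intro h
    exact not_isUnit_zero (hprim 0 fun i => by simp [h])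
  have hsv : grad F ⬝ᵥ v = 0 := by rw [hv, dotProduct_comm, dot_cross_self]
  refine isFreeDivisor_of_syzygies hd hF hred.ne_zero hsyz hsv hg0 fun w hw => ?_
  obtain ⟨r, hr⟩ := exists_cross_eq_smul hprim hw hsyz
  rw [hv] at hr
  obtain ⟨s, hs⟩ := exists_smul_of_cross_eq_zero (isPrimitive_of_isRegular hreg)
    (c := w + r • v) (by
      change (w + r • v) ⨯₃ u = 0
      rw [map_add, map_smul, LinearMap.add_apply, LinearMap.smul_apply, hr, ← smul_add,
        cross_anticomm', smul_zero])
  exact ⟨s, -r, by rw [← hs]; module⟩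

end PlaneCurve

/-! ### Homogeneous parts and graded Nakayama -/

section Graded

variable {σ S : Type*} [CommRing S]

theorem MvPolynomial.IsHomogeneous.homogeneousComponent_mul {p : MvPolynomial σ S} {m : ℕ}
    (hp : p.IsHomogeneous m) (q : MvPolynomial σ S) (k : ℕ) :
    homogeneousComponent k (p * q) = if m ≤ k then p * homogeneousComponent (k - m) q else 0 := by
  have h1 (j) : homogeneousComponent k (p * homogeneousComponent j q) =
      if m + j = k then p * homogeneousComponent j q else 0 :=
    homogeneousComponent_of_mem (hp.mul (homogeneousComponent_isHomogeneous j q)) |>.trans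
      (by simp only [eq_comm])
  conv_lhs => rw [← sum_homogeneousComponent q, Finset.mul_sum, map_sum]
  simp_rw [h1]
  split_ifs with hk
  · rw [Finset.sum_eq_single (k - m)]
    · rw [if_pos (by omega)]
    · intro j _ hj
      rw [if_neg (by omega)]
    · intro hj
      rw [Finset.mem_range] at hj
      rw [homogeneousComponent_eq_zero _ _ (by omega), mul_zero, ite_self]
  · exact Finset.sum_eq_zero fun j _ => if_neg (by omega)

/-- The homogeneous component of degree `k` of a vector of polynomials. -/
noncomputable def homogeneousPart {ι : Type*} (k : ℕ) :
    (ι → MvPolynomial σ S) →ₗ[S] (ι → MvPolynomial σ S) :=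
  (homogeneousComponent k).compLeft ι

variable {ι : Type*}

theorem homogeneousPart_apply (k : ℕ) (v : ι → MvPolynomial σ S) (i : ι) :
    homogeneousPart k v i = homogeneousComponent k (v i) := rfl

theorem isHomogeneous_homogeneousPart (k : ℕ) (v : ι → MvPolynomial σ S) (i : ι) :
    (homogeneousPart k v i).IsHomogeneous k :=
  homogeneousComponent_isHomogeneous k _

theorem exists_sum_homogeneousPart [Finite ι] (v : ι → MvPolynomial σ S) :
    ∃ s : Finset ℕ, ∑ k ∈ s, homogeneousPart k v = v := by
  cases nonempty_fintype ι
  refine ⟨Finset.range ((Finset.univ.sup fun i => (v i).totalDegree) + 1), funext fun i => ?_⟩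
  rw [Finset.sum_apply]
  conv_rhs => rw [← sum_homogeneousComponent (v i)]
  refine (Finset.sum_subset ?_ fun k _ hk => ?_).symm
  · have := Finset.le_sup (f := fun i => (v i).totalDegree) (Finset.mem_univ i)
    exact Finset.range_subset_range.2 (by simpa using this)
  · exact homogeneousComponent_eq_zero _ _ (by simpa using hk)

theorem homogeneousPart_smul_of_isHomogeneous_left {r : MvPolynomial σ S} {m : ℕ}
    (hr : r.IsHomogeneous m) (v : ι → MvPolynomial σ S) (k : ℕ) :
    homogeneousPart k (r • v) = if m ≤ k then r • homogeneousPart (k - m) v else 0 := by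
  funext i
  rw [homogeneousPart_apply, Pi.smul_apply, smul_eq_mul, hr.homogeneousComponent_mul]
  split_ifs <;> rfl

theorem homogeneousPart_smul_of_isHomogeneous_right (r : MvPolynomial σ S) {m : ℕ}
    {v : ι → MvPolynomial σ S} (hv : ∀ i, (v i).IsHomogeneous m) (k : ℕ) :
    homogeneousPart k (r • v) = if m ≤ k then homogeneousComponent (k - m) r • v else 0 := by
  funext i
  rw [homogeneousPart_apply, Pi.smul_apply, smul_eq_mul, mul_comm, (hv i).homogeneousComponent_mul]
  split_ifs
  · rw [mul_comm]; rfl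
  · rfl

theorem homogeneousPart_mem_span {s : Set (ι → MvPolynomial σ S)}
    (hs : ∀ v ∈ s, ∃ k, ∀ i, (v i).IsHomogeneous k) {v : ι → MvPolynomial σ S}
    (hv : v ∈ Submodule.span (MvPolynomial σ S) s) (k : ℕ) :
    homogeneousPart k v ∈ Submodule.span (MvPolynomial σ S) s := by
  induction hv using Submodule.closure_induction with
  | zero => simp
  | add x y _ _ hx hy => rw [map_add]; exact add_mem hx hy
  | smul_mem r x hx =>
    obtain ⟨m, hm⟩ := hs x hx
    rw [homogeneousPart_smul_of_isHomogeneous_right r hm]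
    split_ifs
    · exact Submodule.smul_mem _ _ (Submodule.subset_span hx)
    · exact zero_mem _

/-- Graded Nakayama lemma for submodules of a finite free module over a polynomial ring. -/
theorem le_span_of_le_sup_idealOfVars_smul [Finite ι]
    {N : Submodule (MvPolynomial σ S) (ι → MvPolynomial σ S)}
    {s : Set (ι → MvPolynomial σ S)} (hs : ∀ v ∈ s, ∃ k, ∀ i, (v i).IsHomogeneous k)
    (h : N ≤ Submodule.span _ s ⊔ idealOfVars σ S • N) : N ≤ Submodule.span _ s := by
  -- Induction on the degree: a coefficient in `idealOfVars` has no constant term, so the degree `k`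
  -- part of `r • n` involves only parts of `n` of degree below `k`.
  have key (k : ℕ) : ∀ v ∈ N, homogeneousPart k v ∈ Submodule.span (MvPolynomial σ S) s := by
    induction k using Nat.strong_induction_on with
    | _ k ih =>
      intro v hv
      obtain ⟨p, hp, q, hq, rfl⟩ := Submodule.mem_sup.1 (h hv)
      rw [map_add]
      refine add_mem (homogeneousPart_mem_span hs hp k) ?_
      clear hv
      induction hq using Submodule.smul_induction_on' with
      | add x _ y _ hx hy => rw [map_add]; exact add_mem hx hy
      | smul r hr n hn =>
        conv in r • n => rw [← sum_homogeneousComponent r, Finset.sum_smul]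
        rw [map_sum]
        refine sum_mem fun i _ => ?_
        rw [homogeneousPart_smul_of_isHomogeneous_left (homogeneousComponent_isHomogeneous i r)]
        split_ifs with hik
        · rcases Nat.eq_zero_or_pos i with rfl | hi
          · have : coeff 0 r = 0 := by
              have := (mem_pow_idealOfVars_iff' (σ := σ) (R := S) 1 r).1 (by rwa [pow_one]) 0
              exact this (by simp)
            rw [homogeneousComponent_zero, this, map_zero, zero_smul]
            exact zero_mem _
          · exact Submodule.smul_mem _ _ (ih _ (by omega) n hn)
        · exact zero_mem _
  intro v hv
  obtain ⟨t, ht⟩ := exists_sum_homogeneousPart v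
  rw [← ht]
  exact sum_mem fun k _ => key k v hv

end Graded

/-! ### Homogeneous generators of the syzygies of a free curve -/

namespace PlaneCurve

/-- The linear form `v ↦ grad F ⬝ᵥ v`. -/
noncomputable def gradMap (F : R) : (Fin 3 → R) →ₗ[R] R := Fintype.linearCombination R (grad F)

theorem gradMap_apply (F : R) (v : Fin 3 → R) : gradMap F v = grad F ⬝ᵥ v := by
  rw [gradMap, Fintype.linearCombination_apply, dotProduct_comm]
  rfl

/-- The module of Jacobian syzygies of `F`. -/
noncomputable def syzygies (F : R) : Submodule R (Fin 3 → R) := LinearMap.ker (gradMap F)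

theorem mem_syzygies {F : R} {v : Fin 3 → R} : v ∈ syzygies F ↔ grad F ⬝ᵥ v = 0 := by
  rw [syzygies, LinearMap.mem_ker, gradMap_apply]

/-- The coefficient vectors of the logarithmic derivations. -/
noncomputable def logVec (F : R) : Submodule R (Fin 3 → R) := Submodule.comap (gradMap F) (Ideal.span {F})

theorem mem_logVec {F : R} {v : Fin 3 → R} : v ∈ logVec F ↔ F ∣ grad F ⬝ᵥ v := by
  rw [logVec, Submodule.mem_comap, gradMap_apply, Ideal.mem_span_singleton]

theorem syzygies_le_logVec (F : R) : syzygies F ≤ logVec F := fun v hv => by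
  rw [mem_logVec, mem_syzygies.1 hv]
  exact dvd_zero F

theorem exists_logDer_equiv (F : R) : Nonempty (logDer F ≃ₗ[R] logVec F) := by
  have hmem (θ : logDer F) : (fun i => (θ : Derivation ℂ R R) (X i)) ∈ logVec F := by
    obtain ⟨θ, hθ⟩ := θ
    obtain ⟨w, rfl⟩ := exists_eq_mkDerivation θ
    simpa [mem_logVec] using mkDerivation_mem_logDer_iff.1 hθ
  let e : logDer F →ₗ[R] logVec F :=
    { toFun := fun θ => ⟨_, hmem θ⟩
      map_add' := fun _ _ => rfl
      map_smul' := fun _ _ => rfl }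
  refine ⟨LinearEquiv.ofBijective e ⟨?_, ?_⟩⟩
  · intro θ η h
    exact Subtype.ext (derivation_ext fun i => congrFun (congrArg Subtype.val h) i)
  · rintro ⟨w, hw⟩
    refine ⟨⟨mkDerivation ℂ w, mkDerivation_mem_logDer_iff.2 (mem_logVec.1 hw)⟩, ?_⟩
    exact Subtype.ext (funext fun i => mkDerivation_X ℂ w i)

theorem homogeneousPart_mem_syzygies {F : R} {d : ℕ} (hF : F.IsHomogeneous d)
    {v : Fin 3 → R} (hv : v ∈ syzygies F) (k : ℕ) : homogeneousPart k v ∈ syzygies F := by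
  rw [mem_syzygies] at hv ⊢
  have h := congrArg (homogeneousComponent (d - 1 + k)) hv
  rw [map_zero, dotProduct, map_sum] at h
  rw [← h, dotProduct]
  refine Finset.sum_congr rfl fun i _ => ?_
  rw [IsHomogeneous.homogeneousComponent_mul (p := grad F i) hF.pderiv, if_pos (by omega),
    Nat.add_sub_cancel_left]
  rfl

variable {F : R} {d : ℕ}

/-- For a free curve, the Jacobian syzygies are generated by two homogeneous syzygies. -/
theorem exists_homogeneous_generators (hd : d ≠ 0) (hF : F.IsHomogeneous d) (hF0 : F ≠ 0)
    (hfree : IsFreeDivisor F) :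
    ∃ (u v : Fin 3 → R) (a b : ℕ), (∀ i, (u i).IsHomogeneous a) ∧ (∀ i, (v i).IsHomogeneous b) ∧
      u ∈ syzygies F ∧ v ∈ syzygies F ∧ syzygies F ≤ Submodule.span R {u, v} := by
  classical
  obtain ⟨e⟩ := exists_logDer_equiv F
  have : Module.Free R (logDer F) := hfree
  have : Module.Free R (logVec F) := Module.Free.of_equiv e
  let b := Module.Free.chooseBasis R (logVec F)
  set ι := Module.Free.ChooseBasisIndex R (logVec F)
  have hcard : Fintype.card ι ≤ 3 := by
    rw [← Module.finrank_eq_card_chooseBasisIndex]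
    simpa using Submodule.finrank_le (logVec F)
  have hdC : (d : ℂ) ≠ 0 := Nat.cast_ne_zero.2 hd
  have hdC' : (C (d : ℂ) : R) * C (d : ℂ)⁻¹ = 1 := by
    rw [← C_mul, mul_inv_cancel₀ hdC, C_1]
  -- Constant terms of the coordinates: this is reduction of the free module `logVec F` modulo the
  -- ideal of the variables.
  let ev : logVec F →ₗ[ℂ] (ι → ℂ) :=
    (lcoeff ℂ (0 : Fin 3 →₀ ℕ)).compLeft ι ∘ₗ (b.equivFun.toLinearMap.restrictScalars ℂ)
  have hev (x) (i) : ev x i = coeff 0 (b.repr x i) := rfl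
  let evs : syzygies F →ₗ[ℂ] (ι → ℂ) :=
    ev ∘ₗ (Submodule.inclusion (syzygies_le_logVec F)).restrictScalars ℂ
  choose k hk using fun i => mem_logVec.1 (b i).2
  have hrepr (x : logVec F) : (x : Fin 3 → R) = ∑ i, b.repr x i • (b i : Fin 3 → R) :=
    (congrArg (logVec F).subtype (b.sum_repr x)).symm.trans (map_sum (logVec F).subtype _ _)
  have hX : (X : Fin 3 → R) ∈ logVec F := by
    rw [mem_logVec, grad_dotProduct_X hF]
    exact dvd_mul_left _ _
  have hker (n : syzygies F) (hn : evs n = 0) :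
      (n : Fin 3 → R) ∈ idealOfVars (Fin 3) ℂ • syzygies F := by
    set x := Submodule.inclusion (syzygies_le_logVec F) n
    have h0 : ∑ i, b.repr x i * k i = 0 := by
      refine (mul_eq_zero.1 (?_ : F * _ = 0)).resolve_left hF0
      have h1 : gradMap F (x : Fin 3 → R) = 0 := n.2
      rw [hrepr, map_sum] at h1
      rw [← h1, Finset.mul_sum]
      refine Finset.sum_congr rfl fun i _ => ?_
      rw [map_smul, gradMap_apply, hk, smul_eq_mul]
      ring
    -- Each basis vector is replaced by its projection to the syzygies along the Euler field; the
    -- correction terms cancel by `h0`.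
    have h1 : (n : Fin 3 → R) =
        ∑ i, b.repr x i • ((b i : Fin 3 → R) - (k i * C (d : ℂ)⁻¹) • X) := by
      simp only [smul_sub, Finset.sum_sub_distrib, smul_smul, ← Finset.sum_smul, ← mul_assoc,
        ← Finset.sum_mul, h0, zero_mul, zero_smul, sub_zero]
      exact hrepr x
    rw [h1]
    refine sum_mem fun i _ => Submodule.smul_mem_smul ?_ ?_
    · rw [← pow_one (idealOfVars _ _), mem_pow_idealOfVars_iff']
      intro m hm
      rw [Nat.lt_one_iff, Finsupp.degree_eq_zero_iff] at hm
      rw [hm]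
      exact congrFun hn i
    · rw [mem_syzygies, dotProduct_sub, hk, dotProduct_smul, grad_dotProduct_X hF, smul_eq_mul]
      linear_combination -F * k i * hdC'
  -- If the Euler field agreed with a syzygy modulo the variables, dividing `grad F ⬝ᵥ (X - n) = d
  -- F` by `F` would write `d` as a polynomial without constant term. So the syzygies have a proper
  -- image, of dimension at most `2`.
  have hXrange : ev ⟨X, hX⟩ ∉ LinearMap.range evs := by
    rintro ⟨n, hn⟩
    set y : logVec F := ⟨X, hX⟩ - Submodule.inclusion (syzygies_le_logVec F) n
    have h0 : ev y = 0 := by rw [map_sub, ← hn]; exact sub_self _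
    have h1 : C (d : ℂ) * F = (∑ i, b.repr y i * k i) * F := by
      have h2 : gradMap F (y : Fin 3 → R) = C (d : ℂ) * F := by
        have : gradMap F (n : Fin 3 → R) = 0 := n.2
        rw [← grad_dotProduct_X hF, ← gradMap_apply]
        simp [y, this]
      rw [← h2, hrepr, map_sum, Finset.sum_mul]
      refine Finset.sum_congr rfl fun i _ => ?_
      rw [map_smul, gradMap_apply, hk, smul_eq_mul]
      ring
    have h2 := congrArg constantCoeff (mul_right_cancel₀ hF0 h1)
    simp only [map_sum, map_mul, constantCoeff_C] at h2
    refine hdC (h2.trans (Finset.sum_eq_zero fun i _ => ?_))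
    rw [constantCoeff_eq, ← hev y i, h0]
    exact zero_mul _
  let s : Set (ι → ℂ) := {c | ∃ n : syzygies F, (∃ a, ∀ i, (n.1 i).IsHomogeneous a) ∧ evs n = c}
  have hspan : Submodule.span ℂ s = LinearMap.range evs := by
    refine le_antisymm (Submodule.span_le.2 ?_) ?_
    · rintro _ ⟨n, -, rfl⟩
      exact ⟨n, rfl⟩
    · rintro _ ⟨n, rfl⟩
      obtain ⟨t, ht⟩ := exists_sum_homogeneousPart n.1
      have h1 : n = ∑ a ∈ t, ⟨_, homogeneousPart_mem_syzygies hF n.2 a⟩ :=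
        Subtype.ext (ht.symm.trans (map_sum (syzygies F).subtype
          (fun a => ⟨_, homogeneousPart_mem_syzygies hF n.2 a⟩) t).symm)
      rw [h1, map_sum]
      exact sum_mem fun a _ => Submodule.subset_span
        ⟨_, ⟨a, isHomogeneous_homogeneousPart a n.1⟩, rfl⟩
  have hrank : Module.finrank ℂ (Submodule.span ℂ s) ≤ 2 := by
    have h1 : Module.finrank ℂ (Submodule.span ℂ s) < Module.finrank ℂ (ι → ℂ) := by
      refine Submodule.finrank_lt fun h => hXrange ?_
      rw [← hspan, h]
      trivial
    rw [Module.finrank_fintype_fun_eq_card] at h1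
    omega
  obtain ⟨f, hfs, hfspan, -⟩ := Submodule.exists_fun_fin_finrank_span_eq ℂ s
  choose n hn hnf using hfs
  -- The list is padded by zero, which is homogeneous, so that two generators are available even if
  -- the dimension is smaller.
  let g (j : ℕ) : syzygies F := if h : j < Module.finrank ℂ (Submodule.span ℂ s) then n ⟨j, h⟩ else 0
  have hg (j) : ∃ a, ∀ i, ((g j).1 i).IsHomogeneous a := by
    simp only [g]
    split_ifs
    · exact hn _
    · exact ⟨0, fun i => isHomogeneous_zero _ _ _⟩
  obtain ⟨p, hp⟩ := hg 0
  obtain ⟨q, hq⟩ := hg 1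
  have hgspan : LinearMap.range evs ≤ Submodule.span ℂ {evs (g 0), evs (g 1)} := by
    rw [← hspan, ← hfspan, Submodule.span_le]
    rintro _ ⟨⟨j, hj⟩, rfl⟩
    have h1 : evs (g j) = f ⟨j, hj⟩ := by rw [← hnf]; simp only [g, dif_pos hj]
    rw [← h1]
    obtain rfl | rfl : j = 0 ∨ j = 1 := by omega
    · exact Submodule.subset_span (by simp)
    · exact Submodule.subset_span (by simp)
  refine ⟨_, _, p, q, hp, hq, (g 0).2, (g 1).2, le_span_of_le_sup_idealOfVars_smul ?_ ?_⟩
  · rintro v (rfl | rfl)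
    exacts [⟨p, hp⟩, ⟨q, hq⟩]
  · intro w hw
    obtain ⟨c₀, c₁, hc⟩ := Submodule.mem_span_pair.1 (hgspan ⟨⟨w, hw⟩, rfl⟩)
    refine Submodule.mem_sup.2 ⟨(C c₀ : R) • (g 0).1 + (C c₁ : R) • (g 1).1,
      Submodule.mem_span_pair.2 ⟨_, _, rfl⟩, _,
      hker (⟨w, hw⟩ - (c₀ • g 0 + c₁ • g 1)) ?_, ?_⟩
    · rw [map_sub, ← hc, map_add, map_smul, map_smul, sub_self]
    · funext i
      simp [smul_eq_C_mul]

end PlaneCurve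

/-! ### Taylor polynomials and passage from analytic to polynomial relations -/

theorem MvPolynomial.IsHomogeneous.eval_smul {σ S : Type*} [CommSemiring S]
    {g : MvPolynomial σ S} {j : ℕ} (hg : g.IsHomogeneous j) (t : S) (v : σ → S) :
    eval (t • v) g = t ^ j * eval v g := by
  rw [eval_eq, eval_eq, Finset.mul_sum]
  refine Finset.sum_congr rfl fun m hm => ?_
  simp only [Pi.smul_apply, smul_eq_mul, mul_pow, Finset.prod_mul_distrib]
  rw [Finset.prod_pow_eq_pow_sum, hg.degree_eq_sum_deg_support hm]
  ring

section Taylor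

variable {σ ι : Type*} [Fintype σ]

theorem exists_eval_eq_continuousMultilinearMap {k : ℕ}
    (p : ContinuousMultilinearMap ℂ (fun _ : Fin k => σ → ℂ) ℂ) :
    ∃ T : MvPolynomial σ ℂ, ∀ y, eval y T = p fun _ => y := by
  classical
  refine ⟨∑ r : Fin k → σ, C (p fun l => Pi.single (r l) 1) * ∏ l, X (r l), fun y => ?_⟩
  have hy : y = ∑ i, y i • (Pi.single i 1 : σ → ℂ) := by
    simpa [Pi.single_apply, ← Pi.single_smul] using pi_eq_sum_univ' y
  conv_rhs => rw [hy, p.map_sum]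
  simp [ContinuousMultilinearMap.map_smul_univ, mul_comm]

/-- Taylor polynomials of analytic functions. -/
theorem AnalyticAt.exists_isBigO_sub_eval {f : (σ → ℂ) → ℂ} (hf : AnalyticAt ℂ f 0) (k : ℕ) :
    ∃ T : MvPolynomial σ ℂ, (fun y => f y - eval y T) =O[𝓝 0] fun y => ‖y‖ ^ k := by
  obtain ⟨p, hp⟩ := hf
  choose T hT using fun j => exists_eval_eq_continuousMultilinearMap (p j)
  refine ⟨∑ j ∈ Finset.range k, T j, ?_⟩
  simpa [FormalMultilinearSeries.partialSum, hT] using hp.isBigO_sub_partialSum_pow k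

theorem isBigO_eval_of_mem_pow_idealOfVars {P : MvPolynomial σ ℂ} {k : ℕ}
    (hP : P ∈ idealOfVars σ ℂ ^ k) : (fun y => eval y P) =O[𝓝 0] fun y => ‖y‖ ^ k := by
  rw [mem_pow_idealOfVars_iff] at hP
  simp_rw [eval_eq']
  refine IsBigO.fun_sum fun m hm => ?_
  refine (IsBigO.const_mul_left ?_ _)
  refine IsBigO.of_bound 1 ?_
  filter_upwards [Metric.closedBall_mem_nhds (0 : σ → ℂ) one_pos] with y hy
  rw [mem_closedBall_zero_iff] at hy
  rw [norm_prod, one_mul, norm_pow, norm_norm]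
  calc ∏ i, ‖y i ^ m i‖ ≤ ∏ i, ‖y‖ ^ m i := by
        refine Finset.prod_le_prod (fun _ _ => norm_nonneg _) fun i _ => ?_
        rw [norm_pow]
        exact pow_le_pow_left₀ (norm_nonneg _) (norm_le_pi_norm y i) _
    _ = ‖y‖ ^ m.degree := by rw [Finset.prod_pow_eq_pow_sum, Finsupp.degree_eq_sum]
    _ ≤ ‖y‖ ^ k := pow_le_pow_of_le_one (norm_nonneg _) hy (hP m hm)

theorem MvPolynomial.IsHomogeneous.eq_zero_of_isBigO {g : MvPolynomial σ ℂ} {j : ℕ}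
    (hg : g.IsHomogeneous j) (h : (fun y => eval y g) =O[𝓝 0] fun y => ‖y‖ ^ (j + 1)) : g = 0 := by
  refine MvPolynomial.funext fun v => ?_
  have h1 : Filter.Tendsto (fun t : ℂ => t • v) (𝓝[≠] 0) (𝓝 0) := by
    have : Continuous fun t : ℂ => t • v := by fun_prop
    exact (this.tendsto' 0 0 (zero_smul _ _)).mono_left nhdsWithin_le_nhds
  have h2 : (fun _ : ℂ => eval v g) =O[𝓝[≠] 0] fun t => t := by
    have h3 := h.comp_tendsto h1
    obtain ⟨c, hc⟩ := h3.bound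
    refine IsBigO.of_bound (c * ‖v‖ ^ (j + 1)) ?_
    filter_upwards [hc, self_mem_nhdsWithin] with t ht ht0
    have ht0 : 0 < ‖t‖ := norm_pos_iff.2 ht0
    simp only [Function.comp_apply, hg.eval_smul, norm_mul, norm_pow, norm_norm, norm_smul, mul_pow] at ht
    refine le_of_mul_le_mul_left (ht.trans_eq ?_) (pow_pos ht0 j)
    ring
  have h3 : Filter.Tendsto (fun _ : ℂ => eval v g) (𝓝[≠] 0) (𝓝 0) :=
    h2.trans_tendsto (Filter.tendsto_id.mono_left nhdsWithin_le_nhds)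
  rw [map_zero]
  exact tendsto_nhds_unique tendsto_const_nhds h3

/-- The order of vanishing is raised one degree at a time: the lowest form left in `P` is too small
near the origin, so it vanishes on every line. -/
theorem mem_pow_idealOfVars_of_isBigO {P : MvPolynomial σ ℂ} {k : ℕ}
    (h : (fun y => eval y P) =O[𝓝 0] fun y => ‖y‖ ^ k) : P ∈ idealOfVars σ ℂ ^ k := by
  suffices ∀ j ≤ k, P ∈ idealOfVars σ ℂ ^ j from this k le_rfl
  intro j
  induction j with
  | zero => simp
  | succ j ih =>
    intro hj
    have hPj := (mem_pow_idealOfVars_iff' _ _).1 (ih (by omega))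
    have h1 : P - homogeneousComponent j P ∈ idealOfVars σ ℂ ^ (j + 1) := by
      rw [mem_pow_idealOfVars_iff']
      intro m hm
      rw [coeff_sub, coeff_homogeneousComponent]
      split_ifs with hmj
      · rw [sub_self]
      · rw [sub_zero]
        exact hPj m (by omega)
    have h2 : homogeneousComponent j P = 0 := by
      refine (homogeneousComponent_isHomogeneous j P).eq_zero_of_isBigO ?_
      have h3 : (fun y : σ → ℂ => ‖y‖ ^ k) =O[𝓝 0] fun y => ‖y‖ ^ (j + 1) := by
        refine IsBigO.of_bound 1 ?_
        filter_upwards [Metric.closedBall_mem_nhds (0 : σ → ℂ) one_pos] with y hy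
        rw [mem_closedBall_zero_iff] at hy
        simpa using pow_le_pow_of_le_one (norm_nonneg y) hy hj
      simpa using (h.trans h3).sub (isBigO_eval_of_mem_pow_idealOfVars h1)
    rwa [h2, sub_zero] at h1

/-- Flatness of the analytic germs over the polynomials, for relations: an analytic relation between
polynomials has the same value at the origin as some polynomial relation. -/
theorem exists_polynomial_relation [Fintype ι] (a : ι → MvPolynomial σ ℂ)
    (ξ : ι → (σ → ℂ) → ℂ) (hξ : ∀ i, AnalyticAt ℂ (ξ i) 0)
    (h : ∀ᶠ y in 𝓝 0, ∑ i, ξ i y * eval y (a i) = 0) :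
    ∃ T : ι → MvPolynomial σ ℂ, ∑ i, T i * a i = 0 ∧ ∀ i, eval 0 (T i) = ξ i 0 := by
  set I := idealOfVars σ ℂ
  -- Artin–Rees, applied at exponent `k + 1`: the error of Taylor truncation lies in `I ^ (k + 1)`
  -- and in `(a)`, hence in `I • (a)`. It can be absorbed by coefficients `μ i` that vanish at the
  -- origin.
  obtain ⟨k, hk⟩ := I.exists_pow_inf_eq_pow_smul (Ideal.span (Set.range a))
  choose T hT using fun i => (hξ i).exists_isBigO_sub_eval (k + 1)
  have hG : ∑ i, T i * a i ∈ I ^ (k + 1) := by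
    refine mem_pow_idealOfVars_of_isBigO ?_
    have h1 : (fun y => -∑ i, (ξ i y - eval y (T i)) * eval y (a i)) =O[𝓝 0]
        fun y => ‖y‖ ^ (k + 1) := by
      refine IsBigO.neg_left (IsBigO.fun_sum fun i _ => ?_)
      have h2 : (fun y : σ → ℂ => eval y (a i)) =O[𝓝 0] fun _ => (1 : ℝ) :=
        (MvPolynomial.continuous_eval (a i)).continuousAt.isBigO_one ℝ
      simpa using (hT i).mul h2
    refine h1.congr' ?_ .rfl
    filter_upwards [h] with y hy
    simp only [sub_mul, Finset.sum_sub_distrib, hy, map_sum, map_mul]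
    ring
  have hJ : ∑ i, T i * a i ∈ Ideal.span (Set.range a) :=
    sum_mem fun i _ => Ideal.mul_mem_left _ _ (Ideal.subset_span ⟨i, rfl⟩)
  have hIJ : ∑ i, T i * a i ∈ I • Ideal.span (Set.range a) := by
    have h1 : ∑ i, T i * a i ∈ I ^ (k + 1) • (⊤ : Ideal _) ⊓ Ideal.span (Set.range a) :=
      ⟨by simpa using hG, hJ⟩
    rw [hk (k + 1) (by omega), Nat.add_sub_cancel_left, pow_one] at h1
    exact Submodule.smul_mono le_rfl inf_le_right h1
  obtain ⟨μ, hμ, hμsum⟩ := (Submodule.mem_ideal_smul_span_iff_exists_sum I a _).1 hIJ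
  refine ⟨fun i => T i - μ i, ?_, fun i => ?_⟩
  · rw [Finsupp.sum_fintype _ _ (by simp)] at hμsum
    simp only [sub_mul, Finset.sum_sub_distrib, ← hμsum, smul_eq_mul, sub_self]
  · have h1 : eval 0 (μ i) = 0 := by
      have := (mem_pow_idealOfVars_iff' 1 (μ i)).1 (by rw [pow_one]; exact hμ i) 0 (by simp)
      rwa [← constantCoeff_eq, ← eval_zero] at this
    have h2 := IsBigO.eq_zero_of_norm_pow (x₀ := (0 : σ → ℂ)) (by simpa using hT i) k.succ_ne_zero
    rw [map_sub, h1, sub_zero, sub_eq_zero.1 h2]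

end Taylor

/-! ### Quasihomogeneous germs and Euler vector fields -/

section Quasihomogeneous

theorem MvPolynomial.analyticAt_eval {σ : Type*} [Fintype σ] (P : MvPolynomial σ ℂ) (x : σ → ℂ) :
    AnalyticAt ℂ (fun y => eval y P) x :=
  AnalyticOnNhd.eval_mvPolynomial (𝕜 := ℂ) P x trivial

theorem MvPolynomial.hasFDerivAt_eval {σ : Type*} [Fintype σ] (P : MvPolynomial σ ℂ) (x : σ → ℂ) :
    HasFDerivAt (fun y => eval y P)
      (∑ i, eval x (pderiv i P) • ContinuousLinearMap.proj (R := ℂ) (φ := fun _ : σ => ℂ) i) x := by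
  classical
  induction P using MvPolynomial.induction_on with
  | C a =>
    simp only [eval_C]
    refine (hasFDerivAt_const (𝕜 := ℂ) (E := σ → ℂ) a x).congr_fderiv
      (ContinuousLinearMap.ext fun v => ?_)
    simp
  | add p q hp hq =>
    rw [show (fun y => eval y (p + q)) = fun y => eval y p + eval y q by simp]
    refine (hp.fun_add hq).congr_fderiv (ContinuousLinearMap.ext fun v => ?_)
    simp [add_mul, Finset.sum_add_distrib]
  | mul_X p j hp =>
    rw [show (fun y => eval y (p * X j)) = fun y => eval y p * y j by simp]
    refine (hp.fun_mul (hasFDerivAt_apply j x)).congr_fderiv (ContinuousLinearMap.ext fun v => ?_)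
    simp [pderiv_X, Pi.single_apply, add_mul, Finset.sum_add_distrib, Finset.mul_sum, apply_ite,
      mul_assoc]

theorem MvPolynomial.IsWeightedHomogeneous.exists_euler {σ : Type*} [Fintype σ]
    {g : MvPolynomial σ ℂ} {w : σ → ℚ} {m : ℚ} (hg : IsWeightedHomogeneous w g m)
    (hw : ∀ i, 0 < w i) (hg0 : coeff 0 g = 0) :
    ∃ κ : σ → ℂ, ∑ i, C (κ i) * (X i * pderiv i g) = g := by
  classical
  -- If `g = 0` the value of `m` is irrelevant; otherwise `m > 0`, because `g` has no constant term
  -- and the weights are positive.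
  refine ⟨fun i => ((w i / m : ℚ) : ℂ), ?_⟩
  ext s
  have h1 (i) : coeff s (X i * pderiv i g) = s i * coeff s g := by
    rw [coeff_X_mul']
    split_ifs with hi
    · rw [coeff_pderiv, tsub_add_cancel_of_le (Finsupp.single_le_iff.2
        (Nat.one_le_iff_ne_zero.2 (Finsupp.mem_support_iff.1 hi))), mul_comm]
      congr 1
      rw [Finsupp.tsub_apply, Finsupp.single_eq_same, ← Nat.cast_add_one,
        Nat.sub_add_cancel (Nat.one_le_iff_ne_zero.2 (Finsupp.mem_support_iff.1 hi))]
    · rw [Finsupp.notMem_support_iff.1 hi, Nat.cast_zero, zero_mul]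
  simp only [coeff_sum, coeff_C_mul, h1]
  simp only [← mul_assoc, ← Finset.sum_mul]
  by_cases hs : coeff s g = 0
  · simp [hs]
  · have h2 : ∑ i, s i * w i = m := by
      have := hg hs
      rw [Finsupp.weight_apply, Finsupp.sum_fintype _ _ (by simp)] at this
      simpa using this
    have hm : 0 < m := by
      obtain ⟨i, hi⟩ : ∃ i, s i ≠ 0 := by
        by_contra! h0
        exact hs (by rwa [show s = 0 from Finsupp.ext h0])
      rw [← h2]
      refine Finset.sum_pos' (fun j _ => mul_nonneg (Nat.cast_nonneg _) (hw j).le)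
        ⟨i, Finset.mem_univ i, mul_pos (Nat.cast_pos.2 (Nat.pos_of_ne_zero hi)) (hw i)⟩
    have h3 : ∑ i, ((w i / m : ℚ) : ℂ) * s i = 1 := by
      have : ∑ i, w i / m * s i = 1 := by
        rw [← div_self hm.ne']
        nth_rewrite 2 [← h2]
        rw [Finset.sum_div]
        exact Finset.sum_congr rfl fun i _ => by ring
      exact_mod_cast congrArg (Rat.cast : ℚ → ℂ) this
    rw [h3, one_mul]

/-- A function with a quasihomogeneous germ lies in its Jacobian ideal. -/
theorem PlaneCurve.IsQuasihomogeneousGerm.exists_vectorField {f : (Fin 2 → ℂ) → ℂ}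
    (hf : ∀ y, DifferentiableAt ℂ f y) (hf0 : f 0 = 0) (h : IsQuasihomogeneousGerm f) :
    ∃ χ : (Fin 2 → ℂ) → (Fin 2 → ℂ), AnalyticAt ℂ χ 0 ∧ χ 0 = 0 ∧
      ∀ᶠ y in 𝓝 0, fderiv ℂ f y (χ y) = f y := by
  obtain ⟨φ, φ', u, g, w, m, hφ, hφ0, hφ', hu, hu0, hw, hg, heq⟩ := h
  have hg0 : coeff 0 g = 0 := by
    have h1 := heq.self_of_nhds
    rw [hφ0, hf0, eval_zero, constantCoeff_eq] at h1
    exact (mul_eq_zero.1 h1.symm).resolve_left hu0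
  obtain ⟨κ, hκ⟩ := hg.exists_euler hw hg0
  let η : (Fin 2 → ℂ) → (Fin 2 → ℂ) := fun q i => κ i * q i
  have hη : AnalyticAt ℂ η 0 := AnalyticAt.pi fun i =>
    analyticAt_const.mul
    ((ContinuousLinearMap.proj (R := ℂ) (φ := fun _ : Fin 2 => ℂ) i).analyticAt 0)
  have hη0 : η 0 = 0 := by funext i; simp [η]
  have hgη (q) : fderiv ℂ (fun y => eval y g) q (η q) = eval q g := by
    rw [(hasFDerivAt_eval g q).fderiv]
    conv_rhs => rw [← hκ]
    simp only [map_sum, map_mul, eval_C, eval_X, sum_apply, smul_apply, ContinuousLinearMap.proj_apply, smul_eq_mul, η]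
    exact Finset.sum_congr rfl fun i _ => by ring
  -- The weighted Euler field `η` fixes `g`, so applied to `f ∘ φ = u g` it gives `e` times `f ∘ φ`.
  -- Since `η` vanishes at the origin, `e 0 = 1`; dividing by `e` and pushing forward along `φ`
  -- gives the required field.
  let e : (Fin 2 → ℂ) → ℂ := fun q => fderiv ℂ u q (η q) / u q + 1
  have he : AnalyticAt ℂ e 0 :=
    ((hu.fderiv.contDiffAt.clm_apply (n := ω) hη.contDiffAt).analyticAt.div hu hu0).add
      analyticAt_const
  have he0 : e 0 = 1 := by simp [e, hη0]
  let τ : (Fin 2 → ℂ) → (Fin 2 → ℂ) := fun q => (e q)⁻¹ • fderiv ℂ φ q (η q)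
  have hτ : AnalyticAt ℂ τ 0 :=
    (he.inv (by rw [he0]; exact one_ne_zero)).smul
      (hφ.fderiv.contDiffAt.clm_apply (n := ω) hη.contDiffAt).analyticAt
  have hτ0 : τ 0 = 0 := by simp [τ, hη0]
  have hτf : ∀ᶠ q in 𝓝 0, fderiv ℂ f (φ q) (τ q) = f (φ q) := by
    filter_upwards [heq.eventually_nhds, hφ.eventually_analyticAt, hu.eventually_analyticAt,
      he.continuousAt.eventually_ne (by rw [he0]; exact one_ne_zero),
      hu.continuousAt.eventually_ne hu0] with q hq hφq huq heq0 huq0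
    have h1 := Filter.EventuallyEq.fderiv_eq (𝕜 := ℂ) hq
    have h2 : fderiv ℂ (fun q => f (φ q)) q = (fderiv ℂ f (φ q)).comp (fderiv ℂ φ q) :=
      fderiv_comp q (hf _) hφq.differentiableAt
    have h3 := fderiv_mul huq.differentiableAt (analyticAt_eval g q).differentiableAt
    have h4 : fderiv ℂ f (φ q) (fderiv ℂ φ q (η q)) = e q * f (φ q) := by
      have := congrArg (fun L => L (η q)) (h2.symm.trans (h1.trans h3))
      simp only [ContinuousLinearMap.comp_apply] at this
      rw [this, hq.self_of_nhds]
      simp [hgη, e]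
      field_simp
      ring
    simp only [τ, map_smul, h4, smul_eq_mul]
    rw [inv_mul_cancel_left₀ heq0]
  have hst := hφ.contDiffAt (n := ω) |>.hasStrictFDerivAt' hφ' (by simp)
  let ψ := hφ.contDiffAt (n := ω) |>.localInverse hφ' (by simp)
  have hψ : AnalyticAt ℂ ψ 0 := by
    have := hφ.contDiffAt (n := ω) |>.to_localInverse hφ' (by simp)
    rw [hφ0] at this
    exact this.analyticAt
  have hψ0 : ψ 0 = 0 := by
    have := hφ.contDiffAt (n := ω) |>.localInverse_apply_image hφ' (by simp)
    rwa [hφ0] at this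
  have hψr : ∀ᶠ y in 𝓝 0, φ (ψ y) = y := by
    have := hst.eventually_right_inverse
    rwa [hφ0] at this
  refine ⟨fun y => τ (ψ y), ?_, (congrArg τ hψ0).trans hτ0, ?_⟩
  · rw [← hψ0] at hτ
    exact hτ.comp hψ
  · have := hψ.continuousAt.tendsto
    rw [hψ0] at this
    filter_upwards [hψr, this.eventually hτf] with y h1 h2
    rwa [h1] at h2

end Quasihomogeneous

/-! ### A syzygy that does not vanish at a given singular point -/

namespace PlaneCurve

variable {F : R} {d : ℕ}

theorem hasFDerivAt_affineEquation (F : R) (p v w : Fin 3 → ℂ) (q : Fin 2 → ℂ) :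
    HasFDerivAt (affineEquation F p v w)
      (∑ i, eval (p + q 0 • v + q 1 • w) (grad F i) •
        (v i • ContinuousLinearMap.proj (R := ℂ) (φ := fun _ : Fin 2 => ℂ) 0 +
          w i • ContinuousLinearMap.proj (R := ℂ) (φ := fun _ : Fin 2 => ℂ) 1)) q := by
  have h1 (i : Fin 2) := hasFDerivAt_apply (𝕜 := ℂ) (F' := fun _ : Fin 2 => ℂ) i q
  have h2 := (((h1 0).smul_const v).const_add p).fun_add ((h1 1).smul_const w)
  refine ((hasFDerivAt_eval F _).comp q h2).congr_fderiv (ContinuousLinearMap.ext fun t => ?_)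
  simp [grad, Fin.sum_univ_three]
  ring

theorem grad_dotProduct_eval_self (hF : F.IsHomogeneous d) (x : Fin 3 → ℂ) :
    ∑ i, eval x (grad F i) * x i = d * eval x F := by
  have := congrArg (eval x) (grad_dotProduct_X hF)
  simpa [dotProduct] using this

/-- At a quasihomogeneous singular point, some Jacobian syzygy does not vanish. -/
theorem IsQuasihomogeneousAt.exists_syzygy (hd : d ≠ 0) (hF : F.IsHomogeneous d) {p : Fin 3 → ℂ}
    (hp : ∀ i, eval p (grad F i) = 0) (hq : IsQuasihomogeneousAt F p) :
    ∃ T ∈ syzygies F, ∀ i, eval p (T i) = p i := by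
  obtain ⟨v, w, hli, hgerm⟩ := hq
  have hdC : (d : ℂ) ≠ 0 := Nat.cast_ne_zero.2 hd
  have hp0 : eval p F = 0 := by
    have := grad_dotProduct_eval_self hF p
    simp only [hp, zero_mul, Finset.sum_const_zero] at this
    exact (mul_eq_zero.1 this.symm).resolve_left hdC
  obtain ⟨χ, hχ, hχ0, hχf⟩ := hgerm.exists_vectorField
    (fun y => (hasFDerivAt_affineEquation F p v w y).differentiableAt)
    (by simpa [affineEquation] using hp0)
  let b := basisOfLinearIndependentOfCardEqFinrank hli (by simp)
  have hb (x : Fin 3 → ℂ) : b.repr x 0 • p + b.repr x 1 • v + b.repr x 2 • w = x := by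
    conv_rhs => rw [← b.sum_repr x]
    simp [b, Fin.sum_univ_three]
  let c (j : Fin 3) : (Fin 3 → ℂ) →L[ℂ] ℂ := (b.coord j).toContinuousLinearMap
  have hc (x) : c 0 x • p + c 1 x • v + c 2 x • w = x := hb x
  have hbp : b 0 = p := by simp [b]
  have hcp (j) : c j p = if j = 0 then 1 else 0 := by
    change b.repr p j = _
    rw [← hbp, b.repr_self, Finsupp.single_apply]
    simp only [eq_comm]
  have hcan (j) : AnalyticAt ℂ (fun y => c j (p + y)) 0 :=
    (c j).analyticAt _ |>.comp (analyticAt_const.add analyticAt_id)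
  -- Chart coordinates of the point `[p + y]`: up to the factor `c 0 (p + y)`, the vector `p + y` is
  -- `x = p + q y 0 • v + q y 1 • w`.
  let q : (Fin 3 → ℂ) → (Fin 2 → ℂ) := fun y j => c j.succ (p + y) / c 0 (p + y)
  have hqan : AnalyticAt ℂ q 0 := AnalyticAt.pi fun j => (hcan _).div (hcan 0) (by simp [hcp])
  have hq0 : q 0 = 0 := by
    funext j
    simp [q, hcp]
  have hχq : AnalyticAt ℂ (fun y => χ (q y)) 0 := by
    rw [← hq0] at hχ
    exact hχ.comp hqan
  have hco {f : (Fin 3 → ℂ) → Fin 2 → ℂ} (hf : AnalyticAt ℂ f 0) (j : Fin 2) :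
      AnalyticAt ℂ (fun y => f y j) 0 :=
    (ContinuousLinearMap.proj (R := ℂ) (φ := fun _ : Fin 2 => ℂ) j).analyticAt _ |>.comp hf
  -- At `x` the Euler field sends `F` to `d F` and the lift of `χ` sends `F` to `F`, so this
  -- difference annihilates `F`. Its value at `y = 0` is `p` since `χ 0 = 0`.
  let ξ : Fin 3 → (Fin 3 → ℂ) → ℂ := fun i y =>
    p i + q y 0 * v i + q y 1 * w i - d * (χ (q y) 0 * v i + χ (q y) 1 * w i)
  have hξ (i) : AnalyticAt ℂ (ξ i) 0 :=
    ((analyticAt_const.add ((hco hqan 0).mul analyticAt_const)).add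
      ((hco hqan 1).mul analyticAt_const)).sub (analyticAt_const.mul
      (((hco hχq 0).mul analyticAt_const).add ((hco hχq 1).mul analyticAt_const)))
  have hξ0 (i) : ξ i 0 = p i := by simp [ξ, hq0, hχ0]
  -- Translation moves `p` to the origin, where `exists_polynomial_relation` applies, and back.
  let τ (s : Fin 3 → ℂ) : R →ₐ[ℂ] R := aeval fun i => X i + C (s i)
  have hτ (s y : Fin 3 → ℂ) (G : R) : eval y (τ s G) = eval (s + y) G := by
    have : (aeval y).comp (τ s) = aeval (s + y) := by
      refine algHom_ext fun i => ?_
      simp [τ, add_comm]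
    simpa [aeval_eq_eval] using DFunLike.congr_fun this G
  obtain ⟨T, hT, hT0⟩ := exists_polynomial_relation (fun i => τ p (grad F i)) ξ hξ (by
    have h1 := hqan.continuousAt.tendsto
    rw [hq0] at h1
    filter_upwards [h1.eventually hχf, (hcan 0).continuousAt.eventually_ne
      (show c 0 (p + 0) ≠ 0 by simp [hcp])] with y hy hc0
    set x := p + q y 0 • v + q y 1 • w with hx
    have hxy : p + y = c 0 (p + y) • x := by
      conv_lhs => rw [← hc (p + y)]
      simp only [x, smul_add, smul_smul, q]
      congr
      · exact (mul_div_cancel₀ _ hc0).symm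
      · exact (mul_div_cancel₀ _ hc0).symm
    have h2 (i) : eval y (τ p (grad F i)) = c 0 (p + y) ^ (d - 1) * eval x (grad F i) := by
      rw [hτ, hxy]
      nth_rewrite 2 [← hxy]
      exact (IsHomogeneous.pderiv hF).eval_smul _ _
    have h3 := grad_dotProduct_eval_self hF x
    have h4 : affineEquation F p v w (q y) = eval x F := rfl
    rw [(hasFDerivAt_affineEquation F p v w (q y)).fderiv, h4] at hy
    simp only [← hx, Fin.sum_univ_three, add_apply, smul_apply,
      ContinuousLinearMap.proj_apply, smul_eq_mul] at hy h3
    simp only [h2, ξ, Fin.sum_univ_three]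
    have h5 (i) : x i = p i + q y 0 * v i + q y 1 * w i := rfl
    simp only [← h5]
    linear_combination (c 0 (p + y) ^ (d - 1)) * (h3 - d * hy))
  have hττ (G : R) : τ (-p) (τ p G) = G := by
    have : (τ (-p)).comp (τ p) = AlgHom.id ℂ R := by
      refine algHom_ext fun i => ?_
      simp [τ]
    exact DFunLike.congr_fun this G
  refine ⟨fun i => τ (-p) (T i), ?_, fun i => ?_⟩
  · have := congrArg (τ (-p)) hT
    rw [mem_syzygies, dotProduct]
    simpa [hττ, mul_comm] using this
  · rw [hτ, neg_add_cancel, hT0, hξ0]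

end PlaneCurve

/-! ### The ideal of the origin and its height -/

section IdealOfVars

theorem mem_idealOfVars_iff {σ S : Type*} [CommRing S] {f : MvPolynomial σ S} :
    f ∈ idealOfVars σ S ↔ constantCoeff f = 0 := by
  rw [← pow_one (idealOfVars σ S), mem_pow_idealOfVars_iff', constantCoeff_eq]
  simp [Finsupp.degree_eq_zero_iff]

theorem idealOfVars_eq_ker {σ S : Type*} [CommRing S] :
    idealOfVars σ S = RingHom.ker (constantCoeff : MvPolynomial σ S →+* S) := by
  ext f
  rw [mem_idealOfVars_iff, RingHom.mem_ker]

instance {σ S : Type*} [CommRing S] [IsDomain S] : (idealOfVars σ S).IsPrime := by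
  rw [idealOfVars_eq_ker]
  exact RingHom.ker_isPrime _

theorem MvPolynomial.IsHomogeneous.mem_idealOfVars {σ S : Type*} [CommRing S]
    {f : MvPolynomial σ S} {e : ℕ} (he : e ≠ 0) (hf : f.IsHomogeneous e) :
    f ∈ idealOfVars σ S := by
  rw [mem_idealOfVars_iff, constantCoeff_eq]
  exact hf.coeff_eq_zero (by simpa using he.symm)

/-- The origin has codimension at least `3` in three-dimensional affine space. -/
theorem three_le_height_idealOfVars {K : Type*} [Field K] :
    3 ≤ (idealOfVars (Fin 3) K).height := by
  -- Setting the first `k` variables to zero has a prime kernel; `k = 0, 1, 2, 3` gives a strict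
  -- chain of primes.
  let σ (k : ℕ) : MvPolynomial (Fin 3) K →ₐ[K] MvPolynomial (Fin 3) K :=
    aeval fun i => if (i : ℕ) < k then 0 else X i
  have hσX (k : ℕ) (i : Fin 3) : σ k (X i) = if (i : ℕ) < k then 0 else X i := aeval_X _ _
  have hprime (k) : (RingHom.ker (σ k)).IsPrime := RingHom.ker_isPrime _
  have hlt (k : ℕ) (hk : k < 3) : RingHom.ker (σ k) < RingHom.ker (σ (k + 1)) := by
    refine lt_of_le_of_ne (fun f hf => ?_) fun h => ?_
    · have h1 : (σ (k + 1)).comp (σ k) = σ (k + 1) := by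
        refine algHom_ext fun i => ?_
        rw [AlgHom.comp_apply, hσX]
        split_ifs with hi
        · rw [map_zero, hσX, if_pos (by omega)]
        · rfl
      rw [RingHom.mem_ker] at hf ⊢
      rw [← h1, AlgHom.comp_apply, hf, map_zero]
    · have h1 : X ⟨k, hk⟩ ∈ RingHom.ker (σ (k + 1)) := by
        rw [RingHom.mem_ker, hσX, if_pos (by simp)]
      rw [← h, RingHom.mem_ker, hσX, if_neg (by simp)] at h1
      exact X_ne_zero _ h1
  have hle : RingHom.ker (σ 3) ≤ idealOfVars (Fin 3) K := by
    intro f hf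
    have h1 : constantCoeff.comp (σ 3).toRingHom = constantCoeff := by
      refine ringHom_ext (fun a => by simp) fun i => ?_
      change constantCoeff (σ 3 (X i)) = _
      rw [hσX, if_pos i.2]
      simp
    rw [RingHom.mem_ker] at hf
    rw [mem_idealOfVars_iff, ← h1]
    exact (congrArg constantCoeff hf).trans (map_zero _)
  have h0 := Ideal.height_add_one_le_of_lt_of_isPrime (hlt 0 (by norm_num))
  have h1 := Ideal.height_add_one_le_of_lt_of_isPrime (hlt 1 (by norm_num))
  have h2 := Ideal.height_add_one_le_of_lt_of_isPrime (hlt 2 (by norm_num))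
  refine le_trans ?_ (Ideal.height_mono hle)
  refine le_trans ?_ h2
  refine le_trans ?_ (add_le_add_left h1 1)
  refine le_trans ?_ (add_le_add_left (add_le_add_left h0 1) 1)
  refine le_trans ?_ (add_le_add_left (add_le_add_left (add_le_add_left zero_le 1) 1) 1)
  norm_num

theorem height_idealOfVars_le {K : Type*} [Field K] :
    (idealOfVars (Fin 3) K).height ≤ 3 := by
  have h1 : idealOfVars (Fin 3) K ∈
      (Ideal.span (Set.range (X : Fin 3 → MvPolynomial (Fin 3) K))).minimalPrimes := by
    rw [← idealOfVars, Ideal.minimalPrimes_eq_subsingleton_self]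
    rfl
  refine (Ideal.height_le_card_of_mem_minimalPrimes_span (Set.finite_range _) h1).trans ?_
  rw [← Set.image_univ]
  exact_mod_cast (Set.ncard_image_le Set.finite_univ).trans (by simp [Set.ncard_univ])

/-- Modulo the ideal of the variables `g` is a non-zero constant, so each step `j → j + 1` follows
by subtracting `(g - g(0)) k` and dividing by `g(0)`. -/
theorem mem_pow_idealOfVars_of_mul_mem {K σ : Type*} [Field K] {g k : MvPolynomial σ K} {e : ℕ}
    (hg : constantCoeff g ≠ 0) (h : g * k ∈ idealOfVars σ K ^ e) : k ∈ idealOfVars σ K ^ e := by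
  suffices ∀ j ≤ e, k ∈ idealOfVars σ K ^ j from this e le_rfl
  intro j
  induction j with
  | zero => simp
  | succ j ih =>
    intro hj
    have h1 : (g - C (constantCoeff g)) * k ∈ idealOfVars σ K ^ (j + 1) := by
      rw [pow_succ']
      exact Ideal.mul_mem_mul (mem_idealOfVars_iff.2 (by simp)) (ih (by omega))
    have h2 : C (constantCoeff g) * k ∈ idealOfVars σ K ^ (j + 1) := by
      have := sub_mem (Ideal.pow_le_pow_right hj h) h1
      convert this using 1
      ring
    have h3 := Ideal.mul_mem_left _ (C (constantCoeff g)⁻¹) h2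
    rwa [← mul_assoc, ← C_mul, inv_mul_cancel₀ hg, C_1, one_mul] at h3

/-- A nonunit dividing a non-zero homogeneous polynomial vanishes at the origin. -/
theorem MvPolynomial.IsHomogeneous.mem_idealOfVars_of_dvd {K σ : Type*} [Field K]
    {f g : MvPolynomial σ K} {e : ℕ} (hf : f.IsHomogeneous e) (hf0 : f ≠ 0) (hgf : g ∣ f)
    (hg : ¬IsUnit g) : g ∈ idealOfVars σ K := by
  rw [mem_idealOfVars_iff]
  by_contra hg0
  obtain ⟨k, rfl⟩ := hgf
  have hk0 := right_ne_zero_of_mul hf0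
  have hg0' := left_ne_zero_of_mul hf0
  -- If `g(0) ≠ 0`, the cofactor `k` has order at least `e = deg g + deg k`, which forces `g` to be
  -- constant.
  have h1 : k ∈ idealOfVars σ K ^ e := by
    refine mem_pow_idealOfVars_of_mul_mem hg0 ((mem_pow_idealOfVars_iff' _ _).2 fun m hm => ?_)
    exact hf.coeff_eq_zero hm.ne
  have h2 : e ≤ k.totalDegree := by
    obtain ⟨m, hm⟩ := support_nonempty.2 hk0
    exact ((mem_pow_idealOfVars_iff _ _).1 h1 m hm).trans (le_totalDegree hm)
  have h3 := hf.totalDegree hf0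
  rw [totalDegree_mul_of_isDomain hg0' hk0] at h3
  have h4 : g.totalDegree = 0 := by omega
  rw [totalDegree_eq_zero_iff_eq_C] at h4
  rw [h4] at hg hg0'
  exact hg ((C_ne_zero.1 hg0').isUnit.map C)

end IdealOfVars

/-! ### Forms without common zeros are a regular sequence -/

section RegularSequence

theorem idealOfVars_le_radical {σ : Type*} [Finite σ] {s : Set (MvPolynomial σ ℂ)}
    (hs : ∀ q : σ → ℂ, (∀ f ∈ s, eval q f = 0) → q = 0) :
    idealOfVars σ ℂ ≤ (Ideal.span s).radical := by
  rw [← vanishingIdeal_zeroLocus_eq_radical (K := ℂ), idealOfVars, Ideal.span_le]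
  rintro _ ⟨i, rfl⟩ q hq
  rw [hs q fun f hf => by simpa [aeval_eq_eval] using hq f (Ideal.subset_span hf)]
  simp

theorem idealOfVars_mem_minimalPrimes {σ : Type*} [Finite σ] {s : Set (MvPolynomial σ ℂ)}
    (hs : ∀ q : σ → ℂ, (∀ f ∈ s, eval q f = 0) → q = 0) {I : Ideal (MvPolynomial σ ℂ)}
    (hsI : s ⊆ I) (hI : I ≤ idealOfVars σ ℂ) : idealOfVars σ ℂ ∈ I.minimalPrimes := by
  refine ⟨⟨inferInstance, hI⟩, fun P hP _ => (idealOfVars_le_radical hs).trans ?_⟩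
  exact hP.1.radical_le_iff.2 ((Ideal.span_le.2 hsI).trans hP.2)

variable {A B C : MvPolynomial (Fin 3) ℂ} {e : ℕ}

/-- Otherwise, by the Nullstellensatz, the ideal of the origin is minimal over two generators, so
Krull's theorem bounds its height by `2`. -/
theorem not_subset_span_pair (hV : ∀ q : Fin 3 → ℂ, eval q A = 0 → eval q B = 0 → eval q C = 0 →
    q = 0) {g h : MvPolynomial (Fin 3) ℂ} (hg : g ∈ idealOfVars (Fin 3) ℂ)
    (hh : h ∈ idealOfVars (Fin 3) ℂ) : ¬{A, B, C} ⊆ (Ideal.span {g, h} : Set _) := by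
  intro hsub
  have h1 := idealOfVars_mem_minimalPrimes (s := {A, B, C})
    (fun q hq => hV q (hq _ (by simp)) (hq _ (by simp)) (hq _ (by simp))) hsub
    (Ideal.span_le.2 (by rintro _ (rfl | rfl) <;> assumption))
  have h2 := Ideal.height_le_card_of_mem_minimalPrimes_span (Set.toFinite _) h1
  have h3 : ((({g, h} : Set (MvPolynomial (Fin 3) ℂ)).ncard : ℕ∞)) ≤ 2 := by
    exact_mod_cast (Set.ncard_insert_le g {h}).trans (by simp)
  have h4 := three_le_height_idealOfVars.trans (h2.trans h3)
  norm_num at h4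

theorem isRelPrime_of_zeroLocus (he : e ≠ 0) (hA : A.IsHomogeneous e) (hC : C.IsHomogeneous e)
    (hB : B.IsHomogeneous e)
    (hV : ∀ q : Fin 3 → ℂ, eval q A = 0 → eval q B = 0 → eval q C = 0 → q = 0) :
    A ≠ 0 ∧ IsRelPrime A B := by
  have hA0 : A ≠ 0 := by
    rintro rfl
    refine not_subset_span_pair hV (hB.mem_idealOfVars he) (hC.mem_idealOfVars he) ?_
    rintro _ (rfl | rfl | rfl)
    exacts [zero_mem _, Ideal.subset_span (by simp), Ideal.subset_span (by simp)]
  refine ⟨hA0, fun g hgA hgB => ?_⟩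
  by_contra hg
  refine not_subset_span_pair hV (hA.mem_idealOfVars_of_dvd hA0 hgA hg)
    (hC.mem_idealOfVars he) ?_
  rintro _ (rfl | rfl | rfl)
  exacts [Ideal.mem_of_dvd _ hgA (Ideal.subset_span (by simp)),
    Ideal.mem_of_dvd _ hgB (Ideal.subset_span (by simp)), Ideal.subset_span (by simp)]

/-- An algebra endomorphism of a polynomial ring is the identity modulo any ideal which contains
the differences between the variables and their images. -/
theorem sub_algHom_mem {σ K : Type*} [CommRing K] (ρ : MvPolynomial σ K →ₐ[K] MvPolynomial σ K)
    {I : Ideal (MvPolynomial σ K)} (h : ∀ i, X i - ρ (X i) ∈ I) (f : MvPolynomial σ K) :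
    f - ρ f ∈ I := by
  have : Ideal.Quotient.mkₐ K I = (Ideal.Quotient.mkₐ K I).comp ρ :=
    algHom_ext fun i => Ideal.Quotient.eq.2 (h i)
  exact Ideal.Quotient.eq.1 (DFunLike.congr_fun this f)

/-- The maximal ideal at the origin is not associated to an ideal `(A, B)` with coprime
generators. -/
theorem mem_span_pair_of_idealOfVars_mul_mem (hA0 : A ≠ 0) (hB0 : B ≠ 0) (hAB : IsRelPrime A B)
    {H : MvPolynomial (Fin 3) ℂ}
    (hH : ∀ s ∈ idealOfVars (Fin 3) ℂ, s * H ∈ Ideal.span {A, B}) : H ∈ Ideal.span {A, B} := by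
  -- The linear forms `l₁`, `l₂` cut out the line through the origin and `P`. It is chosen so that
  -- `A` does not vanish on it and `X 0` is a parameter.
  obtain ⟨P, hP⟩ : ∃ P, eval P (A * X 0) ≠ 0 := by
    by_contra! h
    exact mul_ne_zero hA0 (X_ne_zero 0) (MvPolynomial.funext fun P => by simpa using h P)
  rw [map_mul, eval_X] at hP
  have hP0 := right_ne_zero_of_mul hP
  have hPA := left_ne_zero_of_mul hP
  set c₁ := P 1 / P 0
  set c₂ := P 2 / P 0
  set l₁ : MvPolynomial (Fin 3) ℂ := X 1 - MvPolynomial.C c₁ * X 0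
  set l₂ : MvPolynomial (Fin 3) ℂ := X 2 - MvPolynomial.C c₂ * X 0
  obtain ⟨a, b, hab⟩ := Ideal.mem_span_pair.1 (hH l₁ (mem_idealOfVars_iff.2 (by simp [l₁])))
  obtain ⟨a', b', hab'⟩ := Ideal.mem_span_pair.1 (hH l₂ (mem_idealOfVars_iff.2 (by simp [l₂])))
  have h1 : (l₂ * a - l₁ * a') * A = B * (l₁ * b' - l₂ * b) := by
    linear_combination l₂ * hab - l₁ * hab'
  -- Comparing the expressions of `l₁ l₂ H` gives a relation between `A` and `B`, hence a Koszul one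
  -- with factor `h`. On the line `A h = 0`, so `h` lies in `(l₁, l₂)`; this corrects `a` and `b` to
  -- multiples of `l₁`, which is then cancelled.
  obtain ⟨h, hh⟩ := (hAB.symm).dvd_of_dvd_mul_right (Dvd.intro _ h1.symm)
  have h2 : A * h = l₁ * b' - l₂ * b := by
    refine mul_left_cancel₀ hB0 ?_
    rw [← h1, hh]
    ring
  let ρ : MvPolynomial (Fin 3) ℂ →ₐ[ℂ] MvPolynomial (Fin 3) ℂ :=
    aeval ![X 0, MvPolynomial.C c₁ * X 0, MvPolynomial.C c₂ * X 0]
  have hρ : ρ h = 0 := by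
    have h3 : ρ A * ρ h = 0 := by
      rw [← map_mul, h2]
      simp [ρ, l₁, l₂]
    refine (mul_eq_zero.1 h3).resolve_left fun h4 => hPA ?_
    have h5 : (aeval P).comp ρ = (aeval P : MvPolynomial (Fin 3) ℂ →ₐ[ℂ] ℂ) := by
      refine algHom_ext fun i => ?_
      fin_cases i <;> simp [ρ, c₁, c₂, hP0]
    have h6 := DFunLike.congr_fun h5 A
    rw [AlgHom.comp_apply, h4, map_zero] at h6
    simpa [aeval_eq_eval] using h6.symm
  have hmem : h ∈ Ideal.span {l₁, l₂} := by
    have := sub_algHom_mem ρ (I := Ideal.span {l₁, l₂}) (fun i => ?_) h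
    · rwa [hρ, sub_zero] at this
    · fin_cases i
      · simp [ρ]
      · simpa [ρ] using Ideal.subset_span (show l₁ ∈ ({l₁, l₂} : Set _) by simp)
      · simpa [ρ] using Ideal.subset_span (show l₂ ∈ ({l₁, l₂} : Set _) by simp)
  obtain ⟨h₁, h₂, hh'⟩ := Ideal.mem_span_pair.1 hmem
  let τ : MvPolynomial (Fin 3) ℂ →ₐ[ℂ] MvPolynomial (Fin 3) ℂ :=
    aeval ![X 0, MvPolynomial.C c₁ * X 0, X 2]
  have hτ₁ : τ l₁ = 0 := by simp [τ, l₁]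
  have hτ₂ : τ l₂ = l₂ := by simp [τ, l₂]
  have hl₂0 : l₂ ≠ 0 := fun h0 => by
    have := congrArg (eval ![0, 0, 1]) h0
    simp [l₂] at this
  have hdvd {r s : MvPolynomial (Fin 3) ℂ} (hrs : l₂ * r = l₁ * s) : l₁ ∣ r := by
    have h3 : τ r = 0 := by
      have := congrArg τ hrs
      rw [map_mul, map_mul, hτ₁, hτ₂, zero_mul] at this
      exact (mul_eq_zero.1 this).resolve_left hl₂0
    have := sub_algHom_mem τ (I := Ideal.span {l₁}) (fun i => ?_) r
    · rwa [h3, sub_zero, Ideal.mem_span_singleton] at this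
    · fin_cases i
      · simp [τ]
      · exact Ideal.mem_span_singleton.2
          (dvd_of_eq (show l₁ = X 1 - τ (X 1) by simp [τ, l₁]))
      · simp [τ]
  obtain ⟨k, hk⟩ := hdvd (r := a - h₂ * B) (s := a' + h₁ * B)
    (by linear_combination hh - B * hh')
  obtain ⟨l, hl⟩ := hdvd (r := b + h₂ * A) (s := b' - h₁ * A)
    (by linear_combination A * hh' + h2)
  have hl₁0 : l₁ ≠ 0 := fun h0 => by
    have := congrArg (eval ![0, 1, 0]) h0
    simp [l₁] at this
  exact Ideal.mem_span_pair.2 ⟨k, l, mul_left_cancel₀ hl₁0 (by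
    linear_combination hab - A * hk - B * hl)⟩

/-- Three ternary forms of the same positive degree without common zeros in the projective plane
form a regular sequence. -/
theorem isRegular_of_zeroLocus (he : e ≠ 0) (hA : A.IsHomogeneous e) (hB : B.IsHomogeneous e)
    (hC : C.IsHomogeneous e)
    (hV : ∀ q : Fin 3 → ℂ, eval q A = 0 → eval q B = 0 → eval q C = 0 → q = 0) :
    RingTheory.Sequence.IsRegular (MvPolynomial (Fin 3) ℂ) [A, B, C] := by
  obtain ⟨hA0, hAB⟩ := isRelPrime_of_zeroLocus he hA hC hB hV
  have hB0 : B ≠ 0 := (isRelPrime_of_zeroLocus he hB hC hA fun q hb ha hc => hV q ha hb hc).1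
  rw [isRegular_triple_iff]
  refine ⟨fun x hx => (mul_eq_zero.1 hx).resolve_left hA0, fun x hx => ?_, fun G hG => ?_, ?_⟩
  · rw [Ideal.mem_span_singleton] at hx ⊢
    exact hAB.dvd_of_dvd_mul_left hx
  · by_contra hGI
    set I := Ideal.span {A, B}
    -- `J` is the colon ideal `(I : G)`. It contains `A`, `B`, `C`, hence a power of the ideal of
    -- the variables; the least such exponent, if positive, yields `r * G ∉ I` sent into `I` by
    -- every variable.
    let J : Ideal (MvPolynomial (Fin 3) ℂ) := Submodule.comap (LinearMap.mulRight _ G) I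
    have hJ (r) : r ∈ J ↔ r * G ∈ I := Iff.rfl
    have hrad : idealOfVars (Fin 3) ℂ ≤ J.radical := by
      refine (idealOfVars_le_radical (s := {A, B, C}) fun q hq => hV q (hq _ (by simp))
        (hq _ (by simp)) (hq _ (by simp))).trans (Ideal.radical_mono (Ideal.span_le.2 ?_))
      rintro _ (rfl | rfl | rfl)
      exacts [Ideal.mul_mem_right _ _ (Ideal.subset_span (by simp)),
        Ideal.mul_mem_right _ _ (Ideal.subset_span (by simp)), hG]
    have hex := Ideal.exists_pow_le_of_le_radical_of_fg hrad (idealOfVars_fg (Fin 3) ℂ)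
    classical
    have hN := Nat.find_spec hex
    rcases hn : Nat.find hex with _ | n
    · rw [hn, pow_zero, Ideal.one_eq_top] at hN
      exact hGI (by simpa [hJ] using hN (Submodule.mem_top (x := 1)))
    · obtain ⟨r, hr, hrJ⟩ := Set.not_subset.1 (Nat.find_min hex (m := n) (by omega))
      refine hrJ (mem_span_pair_of_idealOfVars_mul_mem hA0 hB0 hAB fun s hs => ?_)
      have h1 : s * r ∈ J := by
        refine hN ?_
        rw [hn, pow_succ']
        exact Ideal.mul_mem_mul hs hr
      rw [hJ, mul_assoc] at h1
      exact h1
  · refine ((Ideal.span_le.2 ?_ : _ ≤ idealOfVars (Fin 3) ℂ).trans_lt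
      (Ideal.IsPrime.ne_top inferInstance).lt_top).ne
    rintro _ (rfl | rfl | rfl)
    exacts [hA.mem_idealOfVars he, hB.mem_idealOfVars he, hC.mem_idealOfVars he]

end RegularSequence

/-! ### Finiteness of the singular points and a general combination -/

section LineIdeal

/-- The ideal of the line through the origin and `q`. -/
noncomputable def lineIdeal {σ : Type*} (q : σ → ℂ) : Ideal (MvPolynomial σ ℂ) :=
  RingHom.ker (aeval fun i => Polynomial.X * Polynomial.C (q i) :
    MvPolynomial σ ℂ →ₐ[ℂ] Polynomial ℂ)

variable {σ : Type*} {q : σ → ℂ}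

instance : (lineIdeal q).IsPrime := RingHom.ker_isPrime _

theorem mem_lineIdeal {f : MvPolynomial σ ℂ} : f ∈ lineIdeal q ↔ ∀ t : ℂ, eval (t • q) f = 0 := by
  have h (t : ℂ) : Polynomial.aeval t (aeval (fun i => Polynomial.X * Polynomial.C (q i)) f) =
      eval (t • q) f := by
    have : (Polynomial.aeval t).comp (aeval fun i => Polynomial.X * Polynomial.C (q i)) =
        (aeval (t • q) : MvPolynomial σ ℂ →ₐ[ℂ] ℂ) := by
      refine algHom_ext fun i => ?_
      simpa using mul_comm _ _
    simpa [aeval_eq_eval] using DFunLike.congr_fun this f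
  rw [lineIdeal, RingHom.mem_ker]
  constructor
  · intro hf t
    rw [← h, hf, map_zero]
  · intro hf
    refine Polynomial.funext fun t => ?_
    rw [Polynomial.eval_zero, ← hf t, ← h, Polynomial.coe_aeval_eq_eval]

theorem MvPolynomial.IsHomogeneous.mem_lineIdeal_iff {f : MvPolynomial σ ℂ} {e : ℕ}
    (hf : f.IsHomogeneous e) : f ∈ lineIdeal q ↔ eval q f = 0 := by
  rw [mem_lineIdeal]
  refine ⟨fun h => by simpa using h 1, fun h t => ?_⟩
  rw [hf.eval_smul, h, mul_zero]

theorem lineIdeal_lt_idealOfVars (hq : q ≠ 0) : lineIdeal q < idealOfVars σ ℂ := by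
  refine lt_of_le_of_ne (fun f hf => ?_) fun h => hq (funext fun i => ?_)
  · rw [mem_idealOfVars_iff, ← eval_zero, ← mem_lineIdeal.1 hf 0, zero_smul]
  · have h1 : (X i : MvPolynomial σ ℂ) ∈ lineIdeal q := by
      rw [h, mem_idealOfVars_iff, constantCoeff_X]
    simpa [(isHomogeneous_X ℂ i).mem_lineIdeal_iff] using h1

/-- A smaller prime `P` over `n` would contain a prime element `g`, and `(g) ≠ P` as `n` is
primitive. The chain `0 < (g) < P < lineIdeal q < idealOfVars` is too long for height `3`. -/
theorem lineIdeal_mem_minimalPrimes {ι : Type*} {n : ι → MvPolynomial (Fin 3) ℂ}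
    (hn : IsPrimitive n) {e : ℕ} (hne : ∀ i, (n i).IsHomogeneous e) {q : Fin 3 → ℂ} (hq : q ≠ 0)
    (hnq : ∀ i, eval q (n i) = 0) :
    lineIdeal q ∈ (Ideal.span (Set.range n)).minimalPrimes := by
  refine ⟨⟨inferInstance, Ideal.span_le.2 ?_⟩, fun P hP hPQ => ?_⟩
  · rintro _ ⟨i, rfl⟩
    exact (hne i).mem_lineIdeal_iff.2 (hnq i)
  by_contra hQP
  have := hP.1
  have hmem (i) : n i ∈ P := hP.2 (Ideal.subset_span ⟨i, rfl⟩)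
  have hP0 : P ≠ ⊥ := fun h => not_isUnit_zero <| hn 0 fun i => by
    rw [show n i = 0 by simpa [h] using hmem i]
  obtain ⟨g, hgP, hg⟩ := Ideal.IsPrime.exists_mem_prime_of_ne_bot hP.1 hP0
  have hgprime : (Ideal.span {g}).IsPrime := (Ideal.span_singleton_prime hg.ne_zero).2 hg
  have h1 : (⊥ : Ideal (MvPolynomial (Fin 3) ℂ)) < Ideal.span {g} :=
    bot_lt_iff_ne_bot.2 (by simpa using hg.ne_zero)
  have h2 : Ideal.span {g} < P := by
    refine lt_of_le_of_ne ((Ideal.span_singleton_le_iff_mem _).2 hgP) fun h => hg.not_isUnit ?_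
    exact hn g fun i => Ideal.mem_span_singleton.1 (h ▸ hmem i)
  have h4 := Ideal.height_add_one_le_of_lt_of_isPrime (lineIdeal_lt_idealOfVars hq)
  have h3 := Ideal.height_add_one_le_of_lt_of_isPrime (lt_of_le_not_ge hPQ hQP)
  replace h2 := Ideal.height_add_one_le_of_lt_of_isPrime h2
  replace h1 := Ideal.height_add_one_le_of_lt_of_isPrime h1
  rw [Ideal.height_bot] at h1
  have h5 : (0 + 1 + 1 + 1 + 1 : ℕ∞) ≤ 3 :=
    calc (0 + 1 + 1 + 1 + 1 : ℕ∞) ≤ (Ideal.span {g}).height + 1 + 1 + 1 := by gcongr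
      _ ≤ P.height + 1 + 1 := by gcongr
      _ ≤ (lineIdeal q).height + 1 := by gcongr
      _ ≤ _ := h4.trans height_idealOfVars_le
  norm_num at h5

/-- A Noetherian ring has finitely many minimal primes over an ideal; `S` holds one representative
of each projective zero. -/
theorem exists_finset_lineIdeal {ι : Type*} {n : ι → MvPolynomial (Fin 3) ℂ}
    (hn : IsPrimitive n) {e : ℕ} (hne : ∀ i, (n i).IsHomogeneous e) :
    ∃ S : Finset (Fin 3 → ℂ), (∀ q ∈ S, q ≠ 0 ∧ ∀ i, eval q (n i) = 0) ∧
      ∀ q, q ≠ 0 → (∀ i, eval q (n i) = 0) → ∃ p ∈ S, lineIdeal p = lineIdeal q := by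
  set Z : Set (Fin 3 → ℂ) := {q | q ≠ 0 ∧ ∀ i, eval q (n i) = 0}
  obtain ⟨S, hSZ, hS⟩ := Z.exists_subset_bijOn lineIdeal
  have hfin : (lineIdeal '' Z).Finite :=
    (Ideal.finite_minimalPrimes_of_isNoetherianRing _ (Ideal.span (Set.range n))).subset (by
      rintro _ ⟨q, hq, rfl⟩
      exact lineIdeal_mem_minimalPrimes hn hne hq.1 hq.2)
  have hSfin : S.Finite := hS.finite_iff_finite.2 hfin
  refine ⟨hSfin.toFinset, fun q hq => hSZ (hSfin.mem_toFinset.1 hq), fun q hq hnq => ?_⟩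
  obtain ⟨p, hp, hpq⟩ := hS.surjOn ⟨q, ⟨hq, hnq⟩, rfl⟩
  exact ⟨p, hSfin.mem_toFinset.2 hp, hpq⟩

theorem exists_linearForm_ne_zero [Fintype σ] (S : Finset (σ → ℂ)) (hS : ∀ q ∈ S, q ≠ 0) :
    ∃ l : MvPolynomial σ ℂ, l.IsHomogeneous 1 ∧ ∀ q ∈ S, eval q l ≠ 0 := by
  have h0 : ∏ q ∈ S, ∑ i, MvPolynomial.C (q i) * (X i : MvPolynomial σ ℂ) ≠ 0 := by
    classical
    refine Finset.prod_ne_zero_iff.2 fun q hq h => hS q hq (funext fun i => ?_)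
    have := congrArg (eval (Pi.single i 1)) h
    simpa [Pi.single_apply] using this
  obtain ⟨c, hc⟩ : ∃ c, eval c (∏ q ∈ S, ∑ i, MvPolynomial.C (q i) * X i) ≠ 0 := by
    by_contra! h
    exact h0 (MvPolynomial.funext fun c => by rw [h, map_zero])
  rw [map_prod, Finset.prod_ne_zero_iff] at hc
  refine ⟨∑ i, MvPolynomial.C (c i) * X i,
    IsHomogeneous.sum _ _ _ fun i _ => isHomogeneous_C_mul_X _ _, fun q hq => ?_⟩
  simpa [mul_comm] using hc q hq

/-- A general combination of two vector fields spanning a space of positive dimension at the zeros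
of `n`, and of dimension two elsewhere, has no zeros apart from the origin. -/
theorem exists_smul_add_zeroLocus {n u v : Fin 3 → MvPolynomial (Fin 3) ℂ}
    (hn : IsPrimitive n) {e : ℕ} (hne : ∀ i, (n i).IsHomogeneous e) {a b : ℕ} (hab : a ≤ b)
    (hu : ∀ i, (u i).IsHomogeneous a) (hv : ∀ i, (v i).IsHomogeneous b)
    {r : MvPolynomial (Fin 3) ℂ} (hr : IsUnit r) (huv : u ⨯₃ v = r • n)
    (huv0 : ∀ q ≠ 0, (∀ i, eval q (n i) = 0) → (∀ i, eval q (u i) = 0) →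
      (∀ i, eval q (v i) = 0) → False) :
    ∃ α : MvPolynomial (Fin 3) ℂ, (∀ i, ((α • u + v) i).IsHomogeneous b) ∧
      ∀ q, (∀ i, eval q ((α • u + v) i) = 0) → q = 0 := by
  obtain ⟨S, hS, hS'⟩ := exists_finset_lineIdeal hn hne
  obtain ⟨l, hl, hlS⟩ := exists_linearForm_ne_zero S fun q hq => (hS q hq).1
  obtain ⟨c, hc⟩ : ∃ c : ℂ, ∀ q ∈ S,
      ∃ i, c * eval q l ^ (b - a) * eval q (u i) + eval q (v i) ≠ 0 := by
    have hfin : (⋃ q ∈ S, {c : ℂ | ∀ i, c * eval q l ^ (b - a) * eval q (u i) +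
        eval q (v i) = 0}).Finite := by
      -- Two bad constants at the same `q` would make `u`, and then `v`, vanish there, so each `q`
      -- excludes at most one.
      refine S.finite_toSet.biUnion fun q hq => Set.Subsingleton.finite fun c hc c' hc' => ?_
      by_contra hcc
      have h1 (i) : eval q (u i) = 0 := by
        have h2 : (c - c') * eval q l ^ (b - a) * eval q (u i) = 0 := by
          linear_combination hc i - hc' i
        exact (mul_eq_zero.1 h2).resolve_left
          (mul_ne_zero (sub_ne_zero.2 hcc) (pow_ne_zero _ (hlS q hq)))
      refine huv0 q (hS q hq).1 (hS q hq).2 h1 fun i => ?_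
      simpa [h1] using hc i
    obtain ⟨c, hc⟩ := hfin.exists_notMem
    exact ⟨c, by simpa using hc⟩
  set α := MvPolynomial.C c * l ^ (b - a)
  have hhom (i) : ((α • u + v) i).IsHomogeneous b := by
    refine IsHomogeneous.add ?_ (hv i)
    have := ((hl.pow (b - a)).C_mul c).mul (hu i)
    rwa [one_mul, Nat.sub_add_cancel hab] at this
  refine ⟨α, hhom, fun q hq => ?_⟩
  by_contra hq0
  have hnq (i) : eval q (n i) = 0 := by
    -- Adding a multiple of `u` does not change the cross product, so every zero of the combination
    -- is a zero of `n`.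
    have h1 : u ⨯₃ (α • u + v) = r • n := by
      rw [map_add, map_smul, cross_self, smul_zero, zero_add, huv]
    have h2 : eval q ((r • n) i) = 0 := by
      rw [← h1, cross_apply]
      fin_cases i <;> simp only [Fin.zero_eta, Fin.mk_one, Fin.reduceFinMk, Matrix.cons_val_zero,
        Matrix.cons_val_one, Matrix.cons_val, map_sub, map_mul, hq, mul_zero, sub_zero]
    rw [Pi.smul_apply, smul_eq_mul, map_mul] at h2
    exact (mul_eq_zero.1 h2).resolve_left (hr.map (eval q)).ne_zero
  obtain ⟨p, hp, hpq⟩ := hS' q hq0 hnq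
  obtain ⟨i, hi⟩ := hc p hp
  refine hi ?_
  have h1 : eval p ((α • u + v) i) = 0 := by
    rw [← (hhom i).mem_lineIdeal_iff, hpq, (hhom i).mem_lineIdeal_iff]
    exact hq i
  simpa [α] using h1

end LineIdeal

/-! ### A free quasihomogeneous curve has a regular syzygy -/

namespace PlaneCurve

variable {F : R} {d : ℕ}

theorem cross_cross_cross_left {S : Type*} [CommRing S] (n x y : Fin 3 → S) :
    (n ⨯₃ x) ⨯₃ (n ⨯₃ y) = (n ⬝ᵥ x ⨯₃ y) • n := by
  rw [cross_cross_eq_smul_sub_smul', dot_self_cross, zero_smul, sub_zero, dotProduct_comm,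
    triple_product_permutation]

/-- Two generators of the Jacobian syzygies have the gradient as their cross product, up to a
constant. -/
theorem exists_isUnit_cross_eq_smul (hprim : IsPrimitive (grad F)) {u v : Fin 3 → R}
    (hu : u ∈ syzygies F) (hv : v ∈ syzygies F) (hspan : syzygies F ≤ Submodule.span R {u, v}) :
    ∃ r : R, IsUnit r ∧ u ⨯₃ v = r • grad F := by
  obtain ⟨r, hr⟩ := exists_cross_eq_smul hprim (mem_syzygies.1 hu) (mem_syzygies.1 hv)
  refine ⟨r, ?_, hr⟩
  have hn0 : grad F ≠ 0 := fun h => not_isUnit_zero (hprim 0 fun i => by simp [h])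
  -- The Koszul syzygies `grad F ⨯₃ x` and `grad F ⨯₃ y` are combinations of `u` and `v`, so their
  -- cross product is a multiple of `u ⨯₃ v = r • grad F`. Unit vectors `x`, `y` then show that `r`
  -- divides the entries of `grad F`.
  have hdvd (x y : Fin 3 → R) : r ∣ grad F ⬝ᵥ x ⨯₃ y := by
    obtain ⟨a, b, hab⟩ := Submodule.mem_span_pair.1 (hspan (mem_syzygies.2 (dot_self_cross _ x)))
    obtain ⟨a', b', hab'⟩ := Submodule.mem_span_pair.1 (hspan (mem_syzygies.2 (dot_self_cross _ y)))
    have h1 := cross_cross_cross_left (grad F) x y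
    rw [← hab, ← hab'] at h1
    simp only [map_add, map_smul, LinearMap.add_apply, LinearMap.smul_apply, cross_self, smul_zero,
      zero_add, add_zero] at h1
    rw [← cross_anticomm u v, hr, ← sub_eq_zero] at h1
    refine ⟨a * b' - b * a', sub_eq_zero.1 ((smul_eq_zero.1 (?_ : _ • grad F = 0)).resolve_right hn0)⟩
    rw [← neg_eq_zero, ← h1]
    module
  refine hprim r fun i => ?_
  fin_cases i
  · simpa [cross_apply, dotProduct, Fin.sum_univ_three] using hdvd ![0, 1, 0] ![0, 0, 1]
  · simpa [cross_apply, dotProduct, Fin.sum_univ_three] using hdvd ![0, 0, 1] ![1, 0, 0]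
  · simpa [cross_apply, dotProduct, Fin.sum_univ_three] using hdvd ![1, 0, 0] ![0, 1, 0]

theorem isHomogeneous_cross {u v : Fin 3 → R} {a b : ℕ} (hu : ∀ i, (u i).IsHomogeneous a)
    (hv : ∀ i, (v i).IsHomogeneous b) (i : Fin 3) : ((u ⨯₃ v) i).IsHomogeneous (a + b) := by
  rw [cross_apply]
  fin_cases i <;> exact ((hu _).mul (hv _)).sub ((hu _).mul (hv _))

theorem exists_isRegular_of_generators (hd : 2 ≤ d) (hF : F.IsHomogeneous d) (hred : Squarefree F)
    (hqh : IsQuasihomogeneousCurve F) {u v : Fin 3 → R} {a b : ℕ} (hab : a ≤ b)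
    (hua : ∀ i, (u i).IsHomogeneous a) (hvb : ∀ i, (v i).IsHomogeneous b)
    (hu : u ∈ syzygies F) (hv : v ∈ syzygies F) (hspan : syzygies F ≤ Submodule.span R {u, v}) :
    ∃ A B C : R, A.IsHomogeneous b ∧ B.IsHomogeneous b ∧ C.IsHomogeneous b ∧
      IsJacobianSyzygy F A B C ∧ RingTheory.Sequence.IsRegular R [A, B, C] := by
  have hprim := isPrimitive_grad (by omega) hF hred
  have hgrad (i) : (grad F i).IsHomogeneous (d - 1) := hF.pderiv
  obtain ⟨r, hr, huv⟩ := exists_isUnit_cross_eq_smul hprim hu hv hspan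
  -- In degree `0` the vector `u ⨯₃ v` would be constant, while `r • grad F` vanishes at the origin
  -- because `d ≥ 2`.
  have hb : b ≠ 0 := by
    rintro rfl
    obtain rfl : a = 0 := by omega
    refine not_isUnit_zero (hprim 0 fun i => ?_)
    have h1 := isHomogeneous_cross hua hvb i
    have h2 : (u ⨯₃ v) i ∈ idealOfVars (Fin 3) ℂ := by
      rw [huv]
      exact Ideal.mul_mem_left _ _ ((hgrad i).mem_idealOfVars (by omega))
    rw [← totalDegree_zero_iff_isHomogeneous, totalDegree_eq_zero_iff_eq_C] at h1
    rw [mem_idealOfVars_iff, constantCoeff_eq] at h2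
    rw [h2, map_zero, huv, Pi.smul_apply, smul_eq_mul] at h1
    rw [(mul_eq_zero.1 h1).resolve_left hr.ne_zero]
  obtain ⟨α, hhom, hV⟩ := exists_smul_add_zeroLocus hprim hgrad hab hua hvb hr huv
    (fun q hq0 hq huq hvq => by
      obtain ⟨T, hT, hTq⟩ := (hqh q hq0 hq).exists_syzygy (by omega) hF hq
      obtain ⟨s, t, rfl⟩ := Submodule.mem_span_pair.1 (hspan hT)
      exact hq0 (funext fun i => by rw [← hTq i]; simp [huq, hvq]))
  set w := α • u + v
  refine ⟨w 0, w 1, w 2, hhom 0, hhom 1, hhom 2, ?_,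
    isRegular_of_zeroLocus hb (hhom 0) (hhom 1) (hhom 2) fun q h0 h1 h2 => hV q fun i => ?_⟩
  · rw [isJacobianSyzygy_iff, ← mem_syzygies]
    convert add_mem (Submodule.smul_mem _ α hu) hv using 1
    funext i
    fin_cases i <;> rfl
  · fin_cases i <;> assumption

theorem IsFreeDivisor.exists_isRegular (hd : 2 ≤ d) (hF : F.IsHomogeneous d) (hred : Squarefree F)
    (hqh : IsQuasihomogeneousCurve F) (hfree : IsFreeDivisor F) :
    ∃ (e : ℕ) (A B C : R), A.IsHomogeneous e ∧ B.IsHomogeneous e ∧ C.IsHomogeneous e ∧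
      IsJacobianSyzygy F A B C ∧ RingTheory.Sequence.IsRegular R [A, B, C] := by
  obtain ⟨u, v, a, b, hua, hvb, hu, hv, hspan⟩ :=
    exists_homogeneous_generators (by omega) hF hred.ne_zero hfree
  rcases le_total a b with hab | hba
  · exact ⟨b, exists_isRegular_of_generators hd hF hred hqh hab hua hvb hu hv hspan⟩
  · rw [Set.pair_comm] at hspan
    exact ⟨a, exists_isRegular_of_generators hd hF hred hqh hba hvb hua hv hu hspan⟩

end PlaneCurve

theorem theorem2p2 (F : PlaneCurve.R) (d : ℕ) (hd : 2 ≤ d)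
    (hF : F.IsHomogeneous d) (hred : Squarefree F)
    (hqh : PlaneCurve.IsQuasihomogeneousCurve F) :
    (PlaneCurve.IsFreeDivisor F ↔
      ∃ A B C : PlaneCurve.R, PlaneCurve.IsJacobianSyzygy F A B C ∧
        RingTheory.Sequence.IsRegular PlaneCurve.R [A, B, C]) ∧
    (PlaneCurve.IsFreeDivisor F →
      ∃ (e : ℕ) (A B C : PlaneCurve.R),
        A.IsHomogeneous e ∧ B.IsHomogeneous e ∧ C.IsHomogeneous e ∧
        PlaneCurve.IsJacobianSyzygy F A B C ∧
        RingTheory.Sequence.IsRegular PlaneCurve.R [A, B, C]) := by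
  have key := PlaneCurve.IsFreeDivisor.exists_isRegular hd hF hred hqh
  refine ⟨⟨fun h => ?_, ?_⟩, key⟩
  · obtain ⟨_, A, B, C, -, -, -, hsyz, hreg⟩ := key h
    exact ⟨A, B, C, hsyz, hreg⟩
  · rintro ⟨A, B, C, hsyz, hreg⟩
    exact PlaneCurve.isFreeDivisor_of_isRegular (by omega) hF hred hsyz hreg
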